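/- Let $\mathbb T^\infty=\mathbb T\times\mathbb T\times\cdots$ be the countably infinite torus with product topology and normalized Haar (product) measure $m$, written $d\theta$; its points are $e^{i\theta}=(e^{i\theta_1},e^{i\theta_2},\dots)$. Let $\mathbb Z_0^\infty$ be the set of integer sequences $\nu=(\nu_1,\nu_2,\dots)$ with only finitely many non-zero entries, and $\mathbb N_0^\infty\subset\mathbb Z_0^\infty$ the subset of those with all $\nu_j\ge 0$. For a finite (complex) Borel measure $\mu$ on $\mathbb T^\infty$, with total variation norm $\|\mu\|_{TV}$, put $\widehat\mu(\nu)=\int e^{-i\nu\cdot\theta}\,d\mu$, and for $\xi=re^{it}$ with $0\le r<1$ define the function on $\mathbb T^\infty$ $$\mu_\xi(e^{i\theta})=\sum_{\nu\in\mathbb Z_0^\infty}\widehat\mu(\nu)\,r^{|\nu_1|+2|\nu_2|+3|\nu_3|+\cdots}\,e^{it(\nu_1+2\nu_2+3\nu_3+\cdots)}\,e^{i\nu\cdot\theta}$$ (an absolutely convergent series), and the radial maximal function $M\mu(e^{i\theta})=\sup_{0<r<1}|\mu_r(e^{i\theta})|$. For $f\in L^1(\mathbb T^\infty)$ let $\widehat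 f(\nu)=\int f(e^{i\theta})e^{-i\nu\cdot\theta}\,d\theta$, and let $f_\xi$ and $Mf$ be defined by the same formulas with $\widehat f$ in place of $\widehat\mu$ (that is, identify $f$ with the measure $f\,dm$). The (Fourier) spectrum of $\mu$ or $f$ is the set of $\nu$ where the Fourier coefficient is non-zero; $H^1(\mathbb T^\infty)$ is the space of $f\in L^1(\mathbb T^\infty)$ with spectrum contained in $\mathbb N_0^\infty$, with the norm of $L^1$; and a finite Borel measure is called analytic if its spectrum is contained in $\mathbb N_0^\infty$. Then: (i) For every finite Borel measure $\mu$ on $\mathbb T^\infty$, $\int_{\mathbb T^\infty}|\mu_\xi(e^{i\theta})|\,d\theta\le\|\mu\|_{TV}$ for all $\xi\in\mathbb C$ with $|\xi|<1$, and $\mu_r\to\mu$ weak-$*$ as $r\nearrow1$, i.e. $\int g\,\mu_r\,d\theta\to\int g\,d\mu$ for every continuous $g:\mathbb T^\infty\to\mathbb C$. (ii) There is $C<\infty$ such that for every finite Borel measure $\mu$ on $\mathbb T^\infty$ with spectrum contained in $\mathbb N_0^\infty\cup(-\mathbb N_0^\infty)$ and every $\lambda>0$, $$m\big(\{e^{i\theta}: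 M\mu(e^{i\theta})>\lambda\}\big)\le\frac{C\|\mu\|_{TV}}{\lambda}.$$ Moreover, for every such $\mu$ the finite radial limit $\lim_{r\to1^-}\mu_r(e^{i\theta})$ exists for almost every $e^{i\theta}\in\mathbb T^\infty$. (iii) For every $f\in L^1(\mathbb T^\infty)$ with spectrum contained in $\mathbb N_0^\infty\cup(-\mathbb N_0^\infty)$, one has $\lim_{r\to1^-}f_r(e^{i\theta})=f(e^{i\theta})$ for almost every $e^{i\theta}\in\mathbb T^\infty$, and $\|f_r-f\|_1\to0$ as $r\nearrow1$. (iv) There is $C<\infty$ such that $\|Mf\|_1\le C\|f\|_{H^1(\mathbb T^\infty)}$ for every $f\in H^1(\mathbb T^\infty)$; likewise there is $C<\infty$ such that $\|M\mu\|_1\le C\|\mu\|_{TV}$ for every analytic measure $\mu$ on $\mathbb T^\infty$. -/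

import Mathlib

open MeasureTheory Filter Topology
open scoped ENNReal NNReal

noncomputable section

namespace InfTorus

/-- The infinite torus `𝕋^∞`, with coordinates `θ = (θ₁, θ₂, …)`, `θ_j ∈ ℝ / 2πℤ`; it carries the
product topology and the product (equivalently, Borel) `σ`-algebra. The coordinate with index
`j : ℕ` is the `(j+1)`-st variable `θ_{j+1}`. -/
abbrev Torus : Type := ℕ → AddCircle (2 * Real.pi)

instance instFactTwoPiPos : Fact (0 < 2 * Real.pi) := ⟨Real.two_pi_pos⟩

/-- The normalized Haar measure `m` of `𝕋^∞` (denoted `dθ`): the infinite product of the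
normalized arc-length measures. -/
def haar : Measure Torus :=
  Measure.infinitePi fun _ : ℕ => (AddCircle.haarAddCircle : Measure (AddCircle (2 * Real.pi)))

/-- The character `e^{iν·θ} = ∏_j e^{i ν_j θ_j}`, for `ν ∈ ℤ_0^∞` (finitely supported). -/
def char (ν : ℕ →₀ ℤ) (θ : Torus) : ℂ :=
  ν.prod fun j n => fourier n (θ j)

/-- The total variation norm `‖μ‖_TV` of a complex Borel measure. -/
def tvNorm (μ : ComplexMeasure Torus) : ℝ≥0∞ :=
  μ.variation Set.univ

/-- The integral `∫ g dμ` of a complex function against a complex Borel measure. -/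
def cintegral (μ : ComplexMeasure Torus) (g : Torus → ℂ) : ℂ :=
  μ.integral g (ContinuousLinearMap.mul ℝ ℂ)

/-- The Fourier coefficients `μ̂(ν) = ∫ e^{-iν·θ} dμ(θ)` of a complex Borel measure. -/
def measureCoeff (μ : ComplexMeasure Torus) (ν : ℕ →₀ ℤ) : ℂ :=
  cintegral μ (char (-ν))

/-- The Fourier coefficients `f̂(ν) = ∫ f(θ) e^{-iν·θ} dm(θ)` of a function. -/
def funCoeff (f : Torus → ℂ) (ν : ℕ →₀ ℤ) : ℂ :=
  ∫ θ, f θ * char (-ν) θ ∂haar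

/-- `|ν*|₁ = |ν₁| + 2|ν₂| + 3|ν₃| + ⋯`. -/
def weight (ν : ℕ →₀ ℤ) : ℕ :=
  ν.sum fun j n => (j + 1) * n.natAbs

/-- `ν₁ + 2ν₂ + 3ν₃ + ⋯`. -/
def twist (ν : ℕ →₀ ℤ) : ℤ :=
  ν.sum fun j n => ((j : ℤ) + 1) * n

/-- For a family `a` of Fourier coefficients and `ξ = r e^{it}`, the sum
`∑_ν a_ν r^{|ν*|₁} e^{it(ν₁ + 2ν₂ + ⋯)} e^{iν·θ}`. The series converges absolutely for `|ξ| < 1`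
when `a` is bounded; at `ξ = 0` only `ν = 0` contributes, so the choice of `t` is immaterial. -/
def extension (a : (ℕ →₀ ℤ) → ℂ) (ξ : ℂ) (θ : Torus) : ℂ :=
  ∑' ν : ℕ →₀ ℤ,
    a ν * (‖ξ‖ : ℂ) ^ weight ν * Complex.exp (Complex.I * (ξ.arg : ℂ) * (twist ν : ℂ)) * char ν θ

/-- `μ_ξ(e^{iθ})` for a complex Borel measure `μ`. -/
def measureExt (μ : ComplexMeasure Torus) (ξ : ℂ) (θ : Torus) : ℂ :=
  extension (measureCoeff μ) ξ θ

/-- `f_ξ(e^{iθ})` for an integrable function `f`. -/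
def funExt (f : Torus → ℂ) (ξ : ℂ) (θ : Torus) : ℂ :=
  extension (funCoeff f) ξ θ

/-- The radial maximal function `Mμ(e^{iθ}) = sup_{0 < r < 1} |μ_r(e^{iθ})|`. -/
def measureMax (μ : ComplexMeasure Torus) (θ : Torus) : ℝ≥0∞ :=
  ⨆ r ∈ Set.Ioo (0 : ℝ) 1, ‖measureExt μ (r : ℂ) θ‖ₑ

/-- The radial maximal function `Mf(e^{iθ}) = sup_{0 < r < 1} |f_r(e^{iθ})|`. -/
def funMax (f : Torus → ℂ) (θ : Torus) : ℝ≥0∞ :=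
  ⨆ r ∈ Set.Ioo (0 : ℝ) 1, ‖funExt f (r : ℂ) θ‖ₑ

/-- The family `a` is supported on `ℕ_0^∞`. -/
def AnalyticSpectrum (a : (ℕ →₀ ℤ) → ℂ) : Prop :=
  ∀ ν : ℕ →₀ ℤ, a ν ≠ 0 → ∀ j, 0 ≤ ν j

/-- The family `a` is supported on `ℕ_0^∞ ∪ (-ℕ_0^∞)`. -/
def HarmonicSpectrum (a : (ℕ →₀ ℤ) → ℂ) : Prop :=
  ∀ ν : ℕ →₀ ℤ, a ν ≠ 0 → (∀ j, 0 ≤ ν j) ∨ (∀ j, ν j ≤ 0)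

/-- `f ∈ H¹(𝕋^∞)`. -/
def MemHardyOne (f : Torus → ℂ) : Prop :=
  Integrable f haar ∧ AnalyticSpectrum (funCoeff f)

/-- The norm `‖f‖₁ = ∫ |f| dm`. -/
def normOne (f : Torus → ℂ) : ℝ≥0∞ :=
  ∫⁻ θ, ‖f θ‖ₑ ∂haar

end InfTorus

end

/-
Along the orbits of the measure-preserving Kronecker flow `t ↦ (θ₁ + t, θ₂ + 2t, θ₃ + 3t, …)` a
series with spectrum in `ℕ₀^∞ ∪ (-ℕ₀^∞)` satisfies `|ν₁ + 2ν₂ + ⋯| = |ν₁| + 2|ν₂| + ⋯`, so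
`r e^{it} ↦ μ_r(flow_t θ)` is a harmonic function in the unit disc, holomorphic when the spectrum
lies in `ℕ₀^∞`. Maximal and convergence theorems in the disc, integrated over all orbits, give the
theorem. The contraction `‖μ_ξ‖₁ ≤ ‖μ‖` holds because `μ_r` is the convolution of `μ` with
`∏_j P_{r^j}(θ_j)`, a nonnegative function of mean one.

In the disc, the Hardy norm is the supremum of the `L¹` means over concentric circles. The weak
type estimate is the Hardy–Littlewood bound, valid for all Poisson means. For holomorphic `F`,
factoring a polynomial into linear factors with outer square roots shows that `|F|^{1/2}` is
dominated by the Poisson integral of its boundary values, and the `L²` maximal inequality applies.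
For radial limits, a harmonic function of finite Hardy norm is a difference of nonnegative ones,
and a nonnegative one is recovered from the bounded holomorphic function `exp(-(u + iv))`.
-/

noncomputable section

namespace InfTorus

/-- The circle `ℝ / 2πℤ`. -/
abbrev Circ : Type := AddCircle (2 * Real.pi)

/-- The normalized arc-length measure on the circle. -/
abbrev arc : Measure Circ := AddCircle.haarAddCircle

section Fourier

variable {T : ℝ}

lemma norm_fourier_apply (n : ℤ) (x : AddCircle T) : ‖fourier n x‖ = 1 :=
  Circle.norm_coe _

lemma fourier_add_arg (n : ℤ) (x y : AddCircle T) :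
    fourier n (x + y) = fourier n x * fourier n y := by
  simp [fourier_apply, smul_add, AddCircle.toCircle_add]

lemma fourier_neg_arg (n : ℤ) (x : AddCircle T) : fourier n (-x) = fourier (-n) x := by
  simp [fourier_apply]

lemma fourier_nsmul_arg (n : ℤ) (k : ℕ) (x : AddCircle T) :
    fourier n (k • x) = fourier (k * n) x := by
  rw [fourier_apply, fourier_apply, ← natCast_zsmul, smul_smul, mul_comm]

lemma fourier_natCast (n : ℕ) (x : AddCircle T) : fourier (n : ℤ) x = fourier 1 x ^ n := by
  simp [fourier_apply, AddCircle.toCircle_nsmul]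

lemma fourier_sum {ι : Type*} (s : Finset ι) (n : ι → ℤ) (x : AddCircle T) :
    fourier (∑ i ∈ s, n i) x = ∏ i ∈ s, fourier (n i) x := by
  induction s using Finset.cons_induction with
  | empty => simp
  | cons i s hi ih => rw [Finset.sum_cons, Finset.prod_cons, fourier_add, ih]

lemma fourier_coe_circ (n : ℤ) (x : ℝ) :
    fourier n (x : Circ) = Complex.exp (Complex.I * x * n) := by
  have : (Real.pi : ℂ) ≠ 0 := by exact_mod_cast Real.pi_ne_zero
  rw [fourier_coe_apply]
  congr 1
  push_cast
  field_simp

lemma integral_fourier (n : ℤ) : ∫ t, fourier n t ∂arc = if n = 0 then 1 else 0 := by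
  split_ifs with hn
  · simp [hn]
  · have hshift := integral_add_right_eq_self (μ := arc) (fun t => fourier n t)
      ((2 * Real.pi / 2 / n : ℝ) : Circ)
    simp only [fourier_add_half_inv_index hn Real.two_pi_pos, integral_neg] at hshift
    exact self_eq_neg.1 hshift.symm

end Fourier

section IntegralLemmas

lemma integrable_of_continuous {X E : Type*} [TopologicalSpace X] [CompactSpace X]
    [MeasurableSpace X] [OpensMeasurableSpace X] {μ : Measure X} [IsFiniteMeasure μ]
    [NormedAddCommGroup E] [SecondCountableTopologyEither X E] {g : X → E} (hg : Continuous g) :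
    Integrable g μ :=
  hg.integrable_of_hasCompactSupport (.of_compactSpace g)

lemma hasSum_integral_of_norm_le {ι X E : Type*} [Countable ι] [MeasurableSpace X]
    {μ : Measure X} [IsFiniteMeasure μ] [NormedAddCommGroup E] [NormedSpace ℝ E]
    {F : ι → X → E} {f : X → E} {u : ι → ℝ} (hF : ∀ i, AEStronglyMeasurable (F i) μ)
    (hu : Summable u) (hle : ∀ i x, ‖F i x‖ ≤ u i) (hf : ∀ x, HasSum (fun i => F i x) (f x)) :
    HasSum (fun i => ∫ x, F i x ∂μ) (∫ x, f x ∂μ) :=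
  hasSum_integral_of_dominated_convergence (fun i _ => u i) hF (fun i => .of_forall (hle i))
    (.of_forall fun _ => hu) (integrable_const _) (.of_forall hf)

end IntegralLemmas

section Characters

@[simp] lemma char_zero (θ : Torus) : char 0 θ = 1 := by simp [char]

lemma char_add (ν ν' : ℕ →₀ ℤ) (θ : Torus) : char (ν + ν') θ = char ν θ * char ν' θ := by
  classical
  exact Finsupp.prod_add_index' (fun _ => fourier_zero) (fun _ _ _ => fourier_add)

lemma char_add_arg (ν : ℕ →₀ ℤ) (θ φ : Torus) : char ν (θ + φ) = char ν θ * char ν φ := by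
  simp only [char, Finsupp.prod, ← Finset.prod_mul_distrib]
  exact Finset.prod_congr rfl fun _ _ => fourier_add_arg _ _ _

lemma char_neg (ν : ℕ →₀ ℤ) (θ : Torus) : char (-ν) θ = (starRingEnd ℂ) (char ν θ) := by
  rw [char, Finsupp.prod_neg_index (h := fun j n => fourier n (θ j)) (fun _ => fourier_zero), char,
    Finsupp.prod, Finsupp.prod, map_prod]
  exact Finset.prod_congr rfl fun _ _ => fourier_neg

lemma char_neg_arg (ν : ℕ →₀ ℤ) (θ : Torus) : char ν (-θ) = char (-ν) θ := by
  rw [char, char,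
    Finsupp.prod_neg_index (h := fun j n => fourier n (θ j)) (fun _ => fourier_zero)]
  exact Finset.prod_congr rfl fun j _ => fourier_neg_arg (ν j) (θ j)

@[simp] lemma norm_char (ν : ℕ →₀ ℤ) (θ : Torus) : ‖char ν θ‖ = 1 := by
  rw [char, Finsupp.prod, norm_prod]
  exact Finset.prod_eq_one fun _ _ => norm_fourier_apply _ _

lemma char_piSingle (ν : ℕ →₀ ℤ) (j : ℕ) (t : Circ) :
    char ν (Pi.single j t) = fourier (ν j) t := by
  rw [char, Finsupp.prod, Finset.prod_eq_single j]
  · simp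
  · intro i _ hij
    simp [Pi.single_eq_of_ne hij]
  · intro hj
    simp [Finsupp.notMem_support_iff.1 hj]

@[fun_prop] lemma continuous_char (ν : ℕ →₀ ℤ) : Continuous (char ν) := by
  unfold char Finsupp.prod
  exact continuous_finsetProd _ fun j _ => (fourier _).continuous.comp (continuous_apply j)

/-- The character `char ν` as an element of `C(𝕋^∞)`, where trigonometric polynomials are dense. -/
def charC (ν : ℕ →₀ ℤ) : C(Torus, ℂ) := ⟨char ν, continuous_char ν⟩

@[simp] lemma charC_apply (ν : ℕ →₀ ℤ) (θ : Torus) : charC ν θ = char ν θ := rfl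

end Characters

section HaarMeasure

instance : IsProbabilityMeasure haar := by unfold haar; infer_instance

instance : haar.IsAddLeftInvariant where
  map_add_left_eq_self φ := by
    have h := Measure.infinitePi_map_pi (fun _ : ℕ => arc) (f := fun j x => φ j + x)
      (fun j => measurable_const_add (φ j))
    simp only [map_add_left_eq_self] at h
    exact h

lemma integral_char (ν : ℕ →₀ ℤ) : ∫ θ, char ν θ ∂haar = if ν = 0 then 1 else 0 := by
  split_ifs with hν
  · simp [hν]
  · obtain ⟨j, hj⟩ := Finsupp.ne_iff.1 hν
    have hhalf : fourier (ν j) ((2 * Real.pi / 2 / ν j : ℝ) : Circ) = -1 := by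
      simpa using fourier_add_half_inv_index hj Real.two_pi_pos (0 : Circ)
    have hshift := integral_add_right_eq_self (μ := haar) (char ν)
      (Pi.single j ((2 * Real.pi / 2 / ν j : ℝ) : Circ))
    simp only [char_add_arg, char_piSingle, hhalf, mul_neg_one, integral_neg] at hshift
    exact self_eq_neg.1 hshift.symm

/-- The Kronecker flow `θ ↦ (θ₁ + t, θ₂ + 2t, θ₃ + 3t, …)` on the torus, with time `t` in the
circle. -/
def flow (t : Circ) (θ : Torus) : Torus := θ + fun j => (j + 1) • t

lemma char_flow (ν : ℕ →₀ ℤ) (t : Circ) (θ : Torus) :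
    char ν (flow t θ) = char ν θ * fourier (twist ν) t := by
  rw [flow, char_add_arg, twist, Finsupp.sum, fourier_sum, char, char, Finsupp.prod]
  simp only [fourier_nsmul_arg, Nat.cast_add, Nat.cast_one, Finsupp.prod]

lemma continuous_flow : Continuous fun p : Circ × Torus => flow p.1 p.2 :=
  continuous_snd.add (continuous_pi fun j => (continuous_nsmul (j + 1)).comp continuous_fst)

lemma measurePreserving_flow (t : Circ) : MeasurePreserving (flow t) haar haar :=
  measurePreserving_add_right haar _

end HaarMeasure

section FinsuppProducts

variable {ι M R : Type*} [Zero M]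

lemma sum_finsupp_prod [CommSemiring R] (s : Finset ι) (t : ι → Finset M) {b : ι → M → R}
    (hb : ∀ i, b i 0 = 1) : ∑ ν ∈ s.finsupp t, ν.prod b = ∏ i ∈ s, ∑ n ∈ t i, b i n := by
  classical
  rw [Finset.prod_sum, Finset.finsupp, Finset.sum_map]
  refine Finset.sum_congr (by congr) fun p _ => ?_
  simp only [Function.Embedding.coeFn_mk]
  rw [Finsupp.prod_of_support_subset _ (Finsupp.support_indicator_subset _ _) _ (fun i _ => hb i),
    ← Finset.prod_attach]
  exact Finset.prod_congr rfl fun i _ => by rw [Finsupp.indicator_of_mem i.2]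

lemma tendsto_finsupp_atTop :
    Tendsto (fun p : Finset ι × Finset M => p.1.finsupp fun _ => p.2) atTop atTop := by
  classical
  refine tendsto_atTop.2 fun u => ?_
  filter_upwards [eventually_ge_atTop
    (u.biUnion Finsupp.support, insert 0 (u.biUnion fun ν => ν.support.image ν))] with p hp ν hν
  rw [Finset.mem_finsupp_iff]
  refine ⟨fun i hi => hp.1 (Finset.mem_biUnion.2 ⟨ν, hν, hi⟩), fun i _ => hp.2 ?_⟩
  by_cases hi : ν i = 0
  · simp [hi]
  · exact Finset.mem_insert_of_mem (Finset.mem_biUnion.2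
      ⟨ν, hν, Finset.mem_image_of_mem ν (Finsupp.mem_support_iff.2 hi)⟩)

lemma summable_finsupp_prod {b : ι → M → ℝ} {c : ι → ℝ} (hb0 : ∀ i n, 0 ≤ b i n)
    (hb : ∀ i, b i 0 = 1) (hsum : ∀ i, HasSum (b i) (1 + c i)) (hc : Summable c) :
    Summable fun ν : ι →₀ M => ν.prod b := by
  classical
  have hprod0 (ν : ι →₀ M) : 0 ≤ ν.prod b := Finset.prod_nonneg fun i _ => hb0 i _
  have hc0 (i : ι) : 0 ≤ c i := by
    simpa [hb] using (hsum i).summable.sum_le_tsum {0} (fun n _ => hb0 i n) |>.trans_eq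
      (hsum i).tsum_eq
  refine summable_of_sum_le (c := Real.exp (∑' i, c i)) hprod0 fun u => ?_
  obtain ⟨⟨s, t⟩, hst⟩ := (tendsto_finsupp_atTop.eventually_ge_atTop u).exists
  calc ∑ ν ∈ u, ν.prod b ≤ ∑ ν ∈ s.finsupp fun _ => t, ν.prod b :=
        Finset.sum_le_sum_of_subset_of_nonneg hst fun ν _ _ => hprod0 ν
    _ = ∏ i ∈ s, ∑ n ∈ t, b i n := sum_finsupp_prod s _ hb
    _ ≤ ∏ i ∈ s, Real.exp (c i) := by
        refine Finset.prod_le_prod (fun i _ => Finset.sum_nonneg fun n _ => hb0 i n) fun i _ => ?_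
        exact (sum_le_hasSum t (fun n _ => hb0 i n) (hsum i)).trans
          ((add_comm 1 (c i)).trans_le (Real.add_one_le_exp (c i)))
    _ = Real.exp (∑ i ∈ s, c i) := (Real.exp_sum s c).symm
    _ ≤ Real.exp (∑' i, c i) := Real.exp_le_exp.2 (hc.sum_le_tsum s fun i _ => hc0 i)

lemma hasProd_of_hasSum_finsupp_prod [CommSemiring R] [TopologicalSpace R]
    [IsTopologicalSemiring R] [RegularSpace R] {b : ι → M → R} {p : ι → R} {S : R}
    (hb : ∀ i, b i 0 = 1) (hp : ∀ i, HasSum (b i) (p i))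
    (hS : HasSum (fun ν : ι →₀ M => ν.prod b) S) : HasProd p S := by
  have hbox : Tendsto (fun q : Finset ι × Finset M => ∏ i ∈ q.1, ∑ n ∈ q.2, b i n) atTop (𝓝 S) := by
    simpa only [Function.comp_def, sum_finsupp_prod _ _ hb] using
      Tendsto.comp hS tendsto_finsupp_atTop
  have hiter (s : Finset ι) : Tendsto (fun t => ∏ i ∈ s, ∑ n ∈ t, b i n) atTop (𝓝 (∏ i ∈ s, p i)) :=
    tendsto_finsetProd s fun i _ => hp i
  refine (closed_nhds_basis S).tendsto_right_iff.2 fun V hV => ?_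
  have hev := hbox.eventually_mem hV.1
  rw [← prod_atTop_atTop_eq] at hev
  filter_upwards [hev.curry] with s hs
  exact hV.2.mem_of_tendsto (hiter s) hs

end FinsuppProducts

section Weights

@[simp] lemma weight_zero : weight 0 = 0 := by simp [weight]

@[simp] lemma weight_neg (ν : ℕ →₀ ℤ) : weight (-ν) = weight ν := by
  rw [weight, Finsupp.sum_neg_index (fun _ => by simp), weight]
  simp only [Int.natAbs_neg]

lemma pow_weight_eq_prod {R : Type*} [CommMonoid R] (r : R) (ν : ℕ →₀ ℤ) :
    r ^ weight ν = ν.prod fun j n => (r ^ (j + 1)) ^ n.natAbs := by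
  simp only [weight, Finsupp.sum, Finsupp.prod, ← Finset.prod_pow_eq_pow_sum, pow_mul]

lemma hasSum_pow_natAbs {q : ℝ} (h0 : 0 ≤ q) (h1 : q < 1) :
    HasSum (fun n : ℤ => q ^ n.natAbs) (1 + 2 * (q / (1 - q))) := by
  have hgeom := hasSum_geometric_of_lt_one h0 h1
  have hgeom_succ : HasSum (fun n : ℕ => q ^ (n + 1)) ((1 - q)⁻¹ * q) := by
    simpa only [← pow_succ] using hgeom.mul_right q
  have hsum := HasSum.of_nat_of_neg_add_one (f := fun n : ℤ => q ^ n.natAbs) (m := (1 - q)⁻¹)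
    (m' := (1 - q)⁻¹ * q) (by simpa using hgeom) hgeom_succ
  convert! hsum using 1
  have : 1 - q ≠ 0 := by linarith
  field_simp
  ring

lemma summable_pow_weight {r : ℝ} (h0 : 0 ≤ r) (h1 : r < 1) :
    Summable fun ν : ℕ →₀ ℤ => r ^ weight ν := by
  have hpow (j : ℕ) : r ^ (j + 1) ≤ r := by
    simpa using pow_le_pow_of_le_one h0 h1.le (Nat.le_add_left 1 j)
  have htail : Summable fun j : ℕ => 2 * (r ^ (j + 1) / (1 - r ^ (j + 1))) := by
    refine Summable.of_nonneg_of_le (fun j => ?_) (fun j => ?_)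
      (((summable_geometric_of_lt_one h0 h1).mul_right (1 - r)⁻¹).mul_left 2)
    · have : 0 ≤ 1 - r ^ (j + 1) := by linarith [hpow j]
      positivity
    · rw [div_eq_mul_inv]
      have : 0 < 1 - r := by linarith
      have : 0 ≤ (1 - r ^ (j + 1))⁻¹ := inv_nonneg.2 (by linarith [hpow j])
      gcongr 2 * (?_ * ?_)
      · exact pow_le_pow_of_le_one h0 h1.le (Nat.le_succ j)
      · exact inv_anti₀ ‹_› (by linarith [hpow j])
  simp only [pow_weight_eq_prod]
  exact summable_finsupp_prod (fun j n => by positivity) (fun j => by simp)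
    (fun j => hasSum_pow_natAbs (by positivity) ((hpow j).trans_lt h1)) htail

end Weights

section Extension

variable {a : (ℕ →₀ ℤ) → ℂ} {A : ℝ}

lemma extension_ofReal {r : ℝ} (hr : 0 ≤ r) (a : (ℕ →₀ ℤ) → ℂ) (θ : Torus) :
    extension a r θ = ∑' ν, a ν * (r : ℂ) ^ weight ν * char ν θ := by
  simp [extension, Complex.arg_ofReal_of_nonneg hr, abs_of_nonneg hr]

lemma extension_eq_flow (a : (ℕ →₀ ℤ) → ℂ) (ξ : ℂ) (θ : Torus) :
    extension a ξ θ = extension a (‖ξ‖ : ℂ) (flow (ξ.arg : Circ) θ) := by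
  rw [extension_ofReal (norm_nonneg _), extension]
  refine tsum_congr fun ν => ?_
  rw [char_flow, fourier_coe_circ]
  ring

lemma norm_extension_term {r : ℝ} (ha : ∀ ν, ‖a ν‖ ≤ A) (hr : 0 ≤ r) (ν : ℕ →₀ ℤ) (θ : Torus) :
    ‖a ν * (r : ℂ) ^ weight ν * char ν θ‖ ≤ A * r ^ weight ν := by
  rw [norm_mul, norm_mul, norm_char, mul_one, norm_pow, Complex.norm_of_nonneg hr]
  exact mul_le_mul_of_nonneg_right (ha ν) (by positivity)

lemma hasSum_extension {r : ℝ} (ha : ∀ ν, ‖a ν‖ ≤ A) (h0 : 0 ≤ r) (h1 : r < 1) (θ : Torus) :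
    HasSum (fun ν => a ν * (r : ℂ) ^ weight ν * char ν θ) (extension a r θ) := by
  rw [extension_ofReal h0]
  exact (Summable.of_norm_bounded ((summable_pow_weight h0 h1).mul_left A)
    fun ν => norm_extension_term ha h0 ν θ).hasSum

lemma continuousOn_extension (ha : ∀ ν, ‖a ν‖ ≤ A) :
    ContinuousOn (fun p : ℝ × Torus => extension a (p.1 : ℂ) p.2) (Set.Ico 0 1 ×ˢ Set.univ) := by
  have hA : 0 ≤ A := (norm_nonneg _).trans (ha 0)
  have hlocal {s : ℝ} (hs0 : 0 ≤ s) (hs1 : s < 1) :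
      ContinuousOn (fun p : ℝ × Torus => extension a (p.1 : ℂ) p.2) (Set.Icc 0 s ×ˢ Set.univ) := by
    refine (continuousOn_tsum
      (f := fun ν (p : ℝ × Torus) => a ν * (p.1 : ℂ) ^ weight ν * char ν p.2)
      (fun ν => Continuous.continuousOn (by fun_prop))
      ((summable_pow_weight hs0 hs1).mul_left A) fun ν p hp => ?_).congr
      fun p hp => extension_ofReal hp.1.1 a p.2
    exact (norm_extension_term ha hp.1.1 ν p.2).trans
      (mul_le_mul_of_nonneg_left (pow_le_pow_left₀ hp.1.1 hp.1.2 _) hA)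
  rintro ⟨r, θ⟩ ⟨hr, -⟩
  obtain ⟨s, hrs, hs1⟩ := exists_between hr.2
  refine (hlocal (hr.1.trans hrs.le) hs1 (r, θ) ⟨⟨hr.1, hrs.le⟩, trivial⟩).mono_of_mem_nhdsWithin ?_
  filter_upwards [self_mem_nhdsWithin, mem_nhdsWithin_of_mem_nhds
    ((continuous_fst.tendsto (r, θ)).eventually (Iio_mem_nhds hrs))] with p hp hps
  exact ⟨⟨hp.1.1, le_of_lt hps⟩, trivial⟩

lemma continuous_extension {r : ℝ} (ha : ∀ ν, ‖a ν‖ ≤ A) (h0 : 0 ≤ r) (h1 : r < 1) :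
    Continuous (extension a (r : ℂ)) :=
  (continuousOn_extension ha).comp_continuous (f := fun θ : Torus => (r, θ)) (by fun_prop)
    fun _ => ⟨⟨h0, h1⟩, trivial⟩

lemma integral_extension_mul_char {r : ℝ} (ha : ∀ ν, ‖a ν‖ ≤ A) (h0 : 0 ≤ r) (h1 : r < 1)
    (ν : ℕ →₀ ℤ) : ∫ θ, extension a r θ * char ν θ ∂haar = a (-ν) * (r : ℂ) ^ weight ν := by
  have hsum := hasSum_integral_of_norm_le (μ := haar)
    (F := fun κ θ => a κ * (r : ℂ) ^ weight κ * char κ θ * char ν θ)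
    (fun κ => Continuous.aestronglyMeasurable (by fun_prop))
    ((summable_pow_weight h0 h1).mul_left A)
    (fun κ θ => by rw [norm_mul, norm_char ν, mul_one]; exact norm_extension_term ha h0 κ θ)
    fun θ => (hasSum_extension ha h0 h1 θ).mul_right (char ν θ)
  simp only [mul_assoc, ← char_add, integral_const_mul, integral_char, add_eq_zero_iff_eq_neg]
    at hsum ⊢
  refine hsum.unique ?_
  convert! hasSum_ite_eq (-ν) (a (-ν) * (r : ℂ) ^ weight ν) using 2 with κ
  split_ifs with hκ <;> simp [hκ]

end Extension

section PoissonKernel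

/-- The Poisson kernel `(1 - r²) / |1 - r e^{it}|²` of the unit disc. -/
def poisson (r : ℝ) (t : Circ) : ℝ := (1 - r ^ 2) / ‖1 - (r : ℂ) * fourier 1 t‖ ^ 2

variable {r : ℝ}

lemma norm_mul_fourier (h0 : 0 ≤ r) (n : ℤ) (t : Circ) : ‖(r : ℂ) * fourier n t‖ = r := by
  rw [norm_mul, norm_fourier_apply, mul_one, Complex.norm_real, Real.norm_of_nonneg h0]

lemma one_sub_le_norm (h0 : 0 ≤ r) (t : Circ) : 1 - r ≤ ‖1 - (r : ℂ) * fourier 1 t‖ := by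
  have := norm_sub_norm_le (1 : ℂ) ((r : ℂ) * fourier 1 t)
  rwa [norm_mul_fourier h0, norm_one] at this

lemma poisson_nonneg (h0 : 0 ≤ r) (h1 : r < 1) (t : Circ) : 0 ≤ poisson r t :=
  div_nonneg (sub_nonneg.2 (pow_le_one₀ h0 h1.le)) (by positivity)

lemma continuous_poisson (h0 : 0 ≤ r) (h1 : r < 1) : Continuous (poisson r) := by
  refine continuous_const.div (by fun_prop) fun t => ?_
  have : 0 < ‖1 - (r : ℂ) * fourier 1 t‖ := (sub_pos.2 h1).trans_le (one_sub_le_norm h0 t)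
  positivity

lemma inv_one_sub_add_conj {w : ℂ} (hw : ‖w‖ < 1) :
    (1 - w)⁻¹ + (1 - starRingEnd ℂ w)⁻¹ * starRingEnd ℂ w =
      ((1 - ‖w‖ ^ 2) / ‖1 - w‖ ^ 2 : ℝ) := by
  have hne : 1 - w ≠ 0 := fun h => by simp [← sub_eq_zero.1 h] at hw
  have hne' : 1 - starRingEnd ℂ w ≠ 0 := by
    simpa using (map_ne_zero (starRingEnd ℂ)).2 hne
  push_cast
  rw [← Complex.mul_conj' w, ← Complex.mul_conj' (1 - w), map_sub, map_one]
  field_simp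
  ring

lemma hasSum_poisson (h0 : 0 ≤ r) (h1 : r < 1) (t : Circ) :
    HasSum (fun n : ℤ => (r : ℂ) ^ n.natAbs * fourier n t) (poisson r t) := by
  set w := (r : ℂ) * fourier 1 t with hw
  have hnorm : ‖w‖ = r := norm_mul_fourier h0 1 t
  have hnat : HasSum (fun n : ℕ => (r : ℂ) ^ (n : ℤ).natAbs * fourier (n : ℤ) t) (1 - w)⁻¹ := by
    simpa only [Int.natAbs_natCast, fourier_natCast, ← mul_pow, ← hw]
      using hasSum_geometric_of_norm_lt_one (hnorm.trans_lt h1)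
  have hneg : HasSum
      (fun n : ℕ => (r : ℂ) ^ (-((n : ℤ) + 1)).natAbs * fourier (-((n : ℤ) + 1)) t)
      ((1 - starRingEnd ℂ w)⁻¹ * starRingEnd ℂ w) := by
    have hgeom := (hasSum_geometric_of_norm_lt_one
      ((RCLike.norm_conj w).trans_lt (hnorm.trans_lt h1))).mul_right (starRingEnd ℂ w)
    convert! hgeom using 2 with n
    rw [← pow_succ, hw, map_mul, Complex.conj_ofReal, mul_pow, ← map_pow, ← fourier_natCast,
      ← fourier_neg, Nat.cast_succ, show (-((n : ℤ) + 1)).natAbs = n + 1 by omega]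
  rw [poisson, ← hw, ← hnorm, ← inv_one_sub_add_conj (hnorm.trans_lt h1), hnorm]
  exact HasSum.of_nat_of_neg_add_one (f := fun n : ℤ => (r : ℂ) ^ n.natAbs * fourier n t) hnat hneg

lemma integral_poisson_mul_fourier (h0 : 0 ≤ r) (h1 : r < 1) (k : ℤ) :
    ∫ τ, (poisson r τ : ℂ) * fourier k τ ∂arc = (r : ℂ) ^ k.natAbs := by
  have hsum := hasSum_integral_of_norm_le (μ := arc)
    (F := fun n : ℤ => fun τ => (r : ℂ) ^ n.natAbs * fourier n τ * fourier k τ)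
    (fun n => Continuous.aestronglyMeasurable (by fun_prop)) (hasSum_pow_natAbs h0 h1).summable
    (fun n τ => by simp only [norm_mul, norm_fourier_apply, mul_one, norm_pow,
      Complex.norm_of_nonneg h0, le_refl])
    fun τ => (hasSum_poisson h0 h1 τ).mul_right (fourier k τ)
  simp only [mul_assoc, ← fourier_add, integral_const_mul, integral_fourier] at hsum
  refine hsum.unique ?_
  convert! hasSum_ite_eq (-k) ((r : ℂ) ^ k.natAbs) using 2 with n
  by_cases hn : n = -k <;> simp [hn, add_eq_zero_iff_eq_neg]

lemma lintegral_poisson (h0 : 0 ≤ r) (h1 : r < 1) :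
    ∫⁻ τ, ENNReal.ofReal (poisson r τ) ∂arc = 1 := by
  have hint := integral_poisson_mul_fourier h0 h1 0
  simp only [fourier_zero, mul_one, Int.natAbs_zero, pow_zero, integral_complex_ofReal] at hint
  rw [← ofReal_integral_eq_lintegral_ofReal (integrable_of_continuous (continuous_poisson h0 h1))
    (.of_forall (poisson_nonneg h0 h1)), Complex.ofReal_eq_one.1 hint, ENNReal.ofReal_one]

end PoissonKernel

section PoissonIntegral

/-- The Poisson integral of a function on the circle. -/
def pint (r : ℝ) (F : Circ → ℂ) (t : Circ) : ℂ := ∫ τ, (poisson r (t - τ) : ℂ) * F τ ∂arc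

variable {r : ℝ} {F : Circ → ℂ}

lemma pint_fourier (h0 : 0 ≤ r) (h1 : r < 1) (k : ℤ) (t : Circ) :
    pint r (fourier k) t = (r : ℂ) ^ k.natAbs * fourier k t := by
  have hsub (τ : Circ) : fourier k (t - τ) = fourier k t * fourier (-k) τ := by
    rw [sub_eq_add_neg, fourier_add_arg, fourier_neg_arg]
  rw [pint, ← integral_sub_left_eq_self _ arc t]
  simp only [sub_sub_cancel, hsub, mul_left_comm _ (fourier k t), integral_const_mul,
    integral_poisson_mul_fourier h0 h1, Int.natAbs_neg]
  rw [mul_comm]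

lemma exists_norm_poisson_le (h0 : 0 ≤ r) (h1 : r < 1) : ∃ B, ∀ t, ‖poisson r t‖ ≤ B := by
  obtain ⟨B, hB⟩ := isCompact_univ.exists_bound_of_continuousOn
    (continuous_poisson h0 h1).continuousOn
  exact ⟨B, fun t => hB t (Set.mem_univ t)⟩

lemma hasSum_pint {ι : Type*} [Countable ι] {F : ι → Circ → ℂ} {f : Circ → ℂ} {u : ι → ℝ}
    (h0 : 0 ≤ r) (h1 : r < 1) (hF : ∀ i, Continuous (F i)) (hu : Summable u)
    (hle : ∀ i τ, ‖F i τ‖ ≤ u i) (hf : ∀ τ, HasSum (fun i => F i τ) (f τ)) (t : Circ) :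
    HasSum (fun i => pint r (F i) t) (pint r f t) := by
  obtain ⟨B, hB⟩ := exists_norm_poisson_le h0 h1
  have hcont := continuous_poisson h0 h1
  refine hasSum_integral_of_norm_le (u := fun i => B * u i)
    (fun i => Continuous.aestronglyMeasurable (by fun_prop)) (hu.mul_left B) (fun i τ => ?_)
    fun τ => (hf τ).mul_left _
  rw [norm_mul, Complex.norm_real]
  exact mul_le_mul (hB _) (hle i τ) (norm_nonneg _) ((norm_nonneg _).trans (hB 0))

lemma pint_const_mul (c : ℂ) (t : Circ) : pint r (fun τ => c * F τ) t = c * pint r F t := by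
  simp only [pint, mul_left_comm _ c, integral_const_mul]

lemma pint_add {G : Circ → ℂ} (h0 : 0 ≤ r) (h1 : r < 1) (hF : Continuous F) (hG : Continuous G)
    (t : Circ) : pint r (fun τ => F τ + G τ) t = pint r F t + pint r G t := by
  have hcont := continuous_poisson h0 h1
  simp only [pint, mul_add]
  exact integral_add (integrable_of_continuous (by fun_prop))
    (integrable_of_continuous (by fun_prop))

lemma enorm_pint_le (h0 : 0 ≤ r) (h1 : r < 1) (F : Circ → ℂ) (t : Circ) :
    ‖pint r F t‖ₑ ≤ ∫⁻ τ, ENNReal.ofReal (poisson r (t - τ)) * ‖F τ‖ₑ ∂arc := by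
  refine (enorm_integral_le_lintegral_enorm _).trans_eq (lintegral_congr fun τ => ?_)
  rw [enorm_mul, ← ofReal_norm (poisson r (t - τ) : ℂ), Complex.norm_real,
    Real.norm_of_nonneg (poisson_nonneg h0 h1 _)]

lemma lintegral_enorm_pint_le (h0 : 0 ≤ r) (h1 : r < 1) (hF : Measurable F) :
    ∫⁻ t, ‖pint r F t‖ₑ ∂arc ≤ ∫⁻ t, ‖F t‖ₑ ∂arc := by
  have hmeas := (continuous_poisson h0 h1).measurable
  calc ∫⁻ t, ‖pint r F t‖ₑ ∂arc
      ≤ ∫⁻ t, ∫⁻ τ, ENNReal.ofReal (poisson r (t - τ)) * ‖F τ‖ₑ ∂arc ∂arc :=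
        lintegral_mono fun t => enorm_pint_le h0 h1 F t
    _ = ∫⁻ τ, ∫⁻ t, ENNReal.ofReal (poisson r (t - τ)) * ‖F τ‖ₑ ∂arc ∂arc :=
        lintegral_lintegral_swap (by fun_prop)
    _ = ∫⁻ τ, ‖F τ‖ₑ ∂arc := lintegral_congr fun τ => by
        rw [lintegral_mul_const _ (by fun_prop),
          lintegral_sub_right_eq_self (μ := arc) (fun t => ENNReal.ofReal (poisson r t)) τ,
          lintegral_poisson h0 h1, one_mul]

lemma circleAverage_eq_integral_arc (f : ℂ → ℂ) :
    Real.circleAverage f 0 1 = ∫ τ, f (fourier 1 τ) ∂arc := by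
  rw [Real.circleAverage_def, AddCircle.integral_haarAddCircle,
    ← AddCircle.intervalIntegral_preimage _ 0, zero_add]
  congr 1
  refine intervalIntegral.integral_congr fun θ _ => ?_
  simp only [fourier_coe_circ, circleMap, zero_add, Complex.ofReal_one, Int.cast_one, mul_one,
    mul_comm]

lemma pint_of_diffContOnCl {h : ℂ → ℂ} (hh : DiffContOnCl ℂ h (Metric.ball 0 1)) (h0 : 0 ≤ r)
    (h1 : r < 1) (t : Circ) : pint r (fun τ => h (fourier 1 τ)) t = h (r * fourier 1 t) := by
  have hmem : (r : ℂ) * fourier 1 t ∈ Metric.ball (0 : ℂ) 1 := by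
    rwa [mem_ball_zero_iff, norm_mul_fourier h0]
  rw [← hh.circleAverage_poissonKernel_smul hmem, circleAverage_eq_integral_arc, pint]
  refine integral_congr_ae (.of_forall fun τ => ?_)
  have hdist : ‖(fourier 1 τ : ℂ) - r * fourier 1 t‖ = ‖1 - (r : ℂ) * fourier 1 (t - τ)‖ := by
    rw [← sub_add_cancel t τ, fourier_add_arg, ← mul_assoc, ← one_sub_mul, norm_mul,
      norm_fourier_apply, mul_one, add_sub_cancel_right]
  simp only [Pi.smul_apply', poissonKernel_def, sub_zero, norm_mul_fourier h0, norm_fourier_apply,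
    hdist, poisson, Complex.real_smul, one_pow]

end PoissonIntegral

section PoissonFamilies

/-- A function on the punctured unit disc in polar coordinates, `U r t` being its value at
`r e^{it}` for `0 < r < 1`, that is the Poisson integral of its values on each larger circle;
equivalently, `U` comes from a harmonic function on the disc. -/
structure IsPoissonFamily (U : ℝ → Circ → ℂ) : Prop where
  continuous : ∀ r ∈ Set.Ioo (0 : ℝ) 1, Continuous (U r)
  continuousOn_radius : ∀ t, ContinuousOn (fun r => U r t) (Set.Ioo 0 1)
  eq_pint : ∀ ⦃r s : ℝ⦄, 0 < r → r < s → s < 1 → ∀ t, U r t = pint (r / s) (U s) t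

lemma isPoissonFamily_of_hasSum {ι : Type*} [Countable ι] {U : ℝ → Circ → ℂ} {b : ι → ℂ}
    {k : ι → ℤ} (hb : ∀ r ∈ Set.Ioo (0 : ℝ) 1, Summable fun i => ‖b i‖ * r ^ (k i).natAbs)
    (hU : ∀ r ∈ Set.Ioo (0 : ℝ) 1, ∀ t,
      HasSum (fun i => b i * ((r : ℂ) ^ (k i).natAbs * fourier (k i) t)) (U r t)) :
    IsPoissonFamily U := by
  have hnorm {r s : ℝ} (h0 : 0 < r) (hrs : r ≤ s) (i : ι) (t : Circ) :
      ‖b i * ((r : ℂ) ^ (k i).natAbs * fourier (k i) t)‖ ≤ ‖b i‖ * s ^ (k i).natAbs := by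
    rw [norm_mul, norm_mul, norm_fourier_apply, mul_one, norm_pow, Complex.norm_of_nonneg h0.le]
    gcongr
  refine ⟨fun r hr => ?_, fun t r hr => ?_, fun r s h0 hrs h1 t => ?_⟩
  · exact (continuous_tsum (fun i => by fun_prop) (hb r hr) (hnorm hr.1 le_rfl)).congr
      fun t => (hU r hr t).tsum_eq
  · obtain ⟨s, hrs, hs1⟩ := exists_between hr.2
    have hcont : ContinuousOn (fun r => U r t) (Set.Ioo 0 s) :=
      (continuousOn_tsum (fun i => Continuous.continuousOn (by fun_prop))
        (hb s ⟨hr.1.trans hrs, hs1⟩) fun i q hq => hnorm hq.1 hq.2.le i t).congr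
        fun q hq => (hU q ⟨hq.1, hq.2.trans hs1⟩ t).tsum_eq.symm
    exact (hcont.continuousAt (Ioo_mem_nhds hr.1 hrs)).continuousWithinAt
  · have hs : s ∈ Set.Ioo (0 : ℝ) 1 := ⟨h0.trans hrs, h1⟩
    have hq0 : 0 ≤ r / s := (div_pos h0 hs.1).le
    have hq1 : r / s < 1 := (div_lt_one hs.1).2 hrs
    have hpint := hasSum_pint hq0 hq1 (fun i => by fun_prop) (hb s hs) (hnorm hs.1 le_rfl)
      (hU s hs) t
    refine (hU r ⟨h0, hrs.trans h1⟩ t).unique ?_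
    convert! hpint using 2 with i
    have hr : (r : ℂ) = s * (r / s : ℝ) := by rw [← Complex.ofReal_mul, mul_div_cancel₀ _ hs.1.ne']
    rw [pint_const_mul, pint_const_mul, pint_fourier hq0 hq1, ← mul_assoc (_ ^ _), ← mul_pow, ← hr]

lemma isPoissonFamily_of_differentiableOn {F : ℂ → ℂ}
    (hF : DifferentiableOn ℂ F (Metric.ball 0 1)) :
    IsPoissonFamily fun r t => F (r * fourier 1 t) := by
  have hmem {r : ℝ} (hr : r ∈ Set.Ioo (0 : ℝ) 1) (t : Circ) :
      (r : ℂ) * fourier 1 t ∈ Metric.ball (0 : ℂ) 1 := by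
    rw [mem_ball_zero_iff, norm_mul_fourier hr.1.le]
    exact hr.2
  refine ⟨fun r hr => hF.continuousOn.comp_continuous (by fun_prop) (hmem hr), fun t =>
    hF.continuousOn.comp (Continuous.continuousOn (by fun_prop)) fun r hr => hmem hr t,
    fun r s h0 hrs h1 t => ?_⟩
  have hs0 : 0 < s := h0.trans hrs
  have hmaps : Set.MapsTo (fun z : ℂ => s * z) (Metric.closedBall 0 1) (Metric.ball 0 1) := by
    intro z hz
    rw [mem_ball_zero_iff, norm_mul, Complex.norm_of_nonneg hs0.le]
    nlinarith [mem_closedBall_zero_iff.1 hz]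
  have hdilate : DiffContOnCl ℂ (fun z => F (s * z)) (Metric.ball 0 1) := by
    refine DifferentiableOn.diffContOnCl ?_
    rw [closure_ball _ one_ne_zero]
    exact hF.comp (by fun_prop) hmaps
  rw [pint_of_diffContOnCl hdilate (div_pos h0 hs0).le ((div_lt_one hs0).2 hrs), ← mul_assoc,
    Complex.ofReal_div, mul_div_cancel₀ _ (Complex.ofReal_ne_zero.2 hs0.ne')]

end PoissonFamilies

section LayerCake

lemma setOf_ofReal_lt_coe_inter_Ioi (b : ℝ≥0) :
    {s : ℝ | ENNReal.ofReal s < b} ∩ Set.Ioi 0 = Set.Ioo 0 (b : ℝ) := by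
  ext s
  refine ⟨fun ⟨hs, h0⟩ => ⟨h0, ?_⟩, fun ⟨h0, hs⟩ => ⟨?_, h0⟩⟩
  · simpa using (ENNReal.ofReal_lt_iff_lt_toReal (le_of_lt h0) ENNReal.coe_ne_top).1 hs
  · exact (ENNReal.ofReal_lt_iff_lt_toReal (le_of_lt h0) ENNReal.coe_ne_top).2 (by simpa using hs)

lemma volume_setOf_ofReal_lt_inter_Ioi (b : ℝ≥0∞) :
    volume ({s : ℝ | ENNReal.ofReal s < b} ∩ Set.Ioi 0) = b := by
  induction b with
  | top => simp
  | coe b =>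
    rw [setOf_ofReal_lt_coe_inter_Ioi, Real.volume_Ioo, sub_zero, ENNReal.ofReal_coe_nnreal]

lemma two_mul_setLIntegral_ofReal (b : ℝ≥0∞) :
    2 * ∫⁻ s in {s : ℝ | ENNReal.ofReal s < b} ∩ Set.Ioi 0, ENNReal.ofReal s = b ^ 2 := by
  induction b with
  | top =>
    have hle : ∞ ≤ ∫⁻ s in Set.Ioi (0 : ℝ), ENNReal.ofReal s := calc
      ∞ = ∫⁻ _ in Set.Ioi (1 : ℝ), 1 := by simp
      _ ≤ ∫⁻ s in Set.Ioi (1 : ℝ), ENNReal.ofReal s :=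
        setLIntegral_mono' measurableSet_Ioi fun s hs => by simpa using le_of_lt hs
      _ ≤ _ := lintegral_mono_set (Set.Ioi_subset_Ioi zero_le_one)
    simp [top_le_iff.1 hle]
  | coe b =>
    have hint : ∫ s in Set.Ioc 0 (b : ℝ), s = (b : ℝ) ^ 2 / 2 :=
      (intervalIntegral.integral_of_le b.2).symm.trans (by simp)
    rw [setOf_ofReal_lt_coe_inter_Ioi, setLIntegral_congr Ioo_ae_eq_Ioc,
      ← ofReal_integral_eq_lintegral_ofReal, hint, ← ENNReal.ofReal_ofNat,
      ← ENNReal.ofReal_mul zero_le_two, mul_div_cancel₀ _ two_ne_zero,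
      ENNReal.ofReal_pow b.coe_nonneg, ENNReal.ofReal_coe_nnreal]
    · exact continuous_id.integrableOn_Icc.mono_set Set.Ioc_subset_Icc_self
    · filter_upwards [ae_restrict_mem measurableSet_Ioc] with s hs using hs.1.le

lemma lintegral_sq_eq_lintegral_measure_lt {X : Type*} [MeasurableSpace X] {μ : Measure X}
    [SFinite μ] {G : X → ℝ≥0∞} (hG : Measurable G) :
    ∫⁻ x, G x ^ 2 ∂μ =
      2 * ∫⁻ s in Set.Ioi (0 : ℝ), ENNReal.ofReal s * μ {x | ENNReal.ofReal s < G x} := by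
  have hset : MeasurableSet {p : X × ℝ | ENNReal.ofReal p.2 < G p.1} :=
    measurableSet_lt (by fun_prop) (by fun_prop)
  have hlt (x : X) : MeasurableSet {s : ℝ | ENNReal.ofReal s < G x} :=
    measurableSet_lt (by fun_prop) measurable_const
  calc ∫⁻ x, G x ^ 2 ∂μ
      = ∫⁻ x, 2 * (∫⁻ s in Set.Ioi (0 : ℝ),
          {s | ENNReal.ofReal s < G x}.indicator (fun s => ENNReal.ofReal s) s) ∂μ := by
        refine lintegral_congr fun x => ?_
        rw [← two_mul_setLIntegral_ofReal, ← setLIntegral_indicator (hlt x)]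
    _ = 2 * ∫⁻ s in Set.Ioi (0 : ℝ), (∫⁻ x,
          {x | ENNReal.ofReal s < G x}.indicator (fun _ => ENNReal.ofReal s) x ∂μ) := by
        rw [lintegral_const_mul' _ _ ENNReal.ofNat_ne_top, lintegral_lintegral_swap]
        · rfl
        · exact (Measurable.indicator (f := fun p : X × ℝ => ENNReal.ofReal p.2) (by fun_prop)
            hset).aemeasurable
    _ = 2 * ∫⁻ s in Set.Ioi (0 : ℝ), ENNReal.ofReal s * μ {x | ENNReal.ofReal s < G x} := by
        congr 1
        exact lintegral_congr fun s =>
          lintegral_indicator_const (measurableSet_lt measurable_const hG) _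

end LayerCake

section HardyLittlewood

variable {X : Type*} [PseudoMetricSpace X] [MeasurableSpace X]

/-- The centred Hardy–Littlewood maximal function of `φ`. -/
def maximal (μ : Measure X) (φ : X → ℝ≥0∞) (x : X) : ℝ≥0∞ :=
  ⨆ (δ : ℝ) (_ : 0 < δ),
    (∫⁻ y in Metric.closedBall x δ, φ y ∂μ) / μ (Metric.closedBall x δ)

variable {μ : Measure X} {φ : X → ℝ≥0∞}

lemma div_le_maximal {δ : ℝ} (hδ : 0 < δ) (x : X) :
    (∫⁻ y in Metric.closedBall x δ, φ y ∂μ) / μ (Metric.closedBall x δ) ≤ maximal μ φ x :=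
  le_iSup₂ (f := fun (δ : ℝ) (_ : 0 < δ) =>
    (∫⁻ y in Metric.closedBall x δ, φ y ∂μ) / μ (Metric.closedBall x δ)) δ hδ

lemma exists_of_lt_maximal {c : ℝ≥0∞} {x : X} {D : ℝ} (hD : 0 < D)
    (hdist : ∀ y, dist y x ≤ D) (hx : c < maximal μ φ x) :
    ∃ δ, 0 < δ ∧ δ ≤ D ∧
      c * μ (Metric.closedBall x δ) ≤ ∫⁻ y in Metric.closedBall x δ, φ y ∂μ := by
  simp only [maximal, lt_iSup_iff] at hx
  obtain ⟨δ, hδ, hc⟩ := hx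
  refine ⟨min δ D, lt_min hδ hD, min_le_right _ _, ?_⟩
  have hball : Metric.closedBall x (min δ D) = Metric.closedBall x δ := by
    ext y
    simp [hdist y]
  rw [hball]
  exact ENNReal.mul_le_of_le_div hc.le

lemma mul_measure_lt_maximal_le [OpensMeasurableSpace X] [SecondCountableTopology X]
    [BoundedSpace X] {K : ℝ≥0∞}
    (hK : ∀ x δ, 0 < δ → μ (Metric.closedBall x (5 * δ)) ≤ K * μ (Metric.closedBall x δ))
    (φ : X → ℝ≥0∞) (c : ℝ≥0∞) : c * μ {x | c < maximal μ φ x} ≤ K * ∫⁻ y, φ y ∂μ := by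
  set E := {x | c < maximal μ φ x}
  obtain ⟨D, hD, hdist⟩ : ∃ D > 0, ∀ x y : X, dist y x ≤ D := by
    obtain ⟨D, hD⟩ := Metric.isBounded_iff.1 (Bornology.IsBounded.all (Set.univ : Set X))
    exact ⟨max D 1, by positivity, fun x y =>
      (hD (Set.mem_univ y) (Set.mem_univ x)).trans (le_max_left _ _)⟩
  choose! δ hδ0 hδD hδ using fun x (hx : x ∈ E) => exists_of_lt_maximal hD (hdist x) hx
  obtain ⟨u, huE, hdisj, hcover⟩ := Vitali.exists_disjoint_subfamily_covering_enlargement_closedBall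
    E id δ D hδD 5 (by norm_num)
  simp only [id] at hdisj hcover
  have hcount : u.Countable := hdisj.countable_of_nonempty_interior fun x hx =>
    ⟨x, mem_interior_iff_mem_nhds.2 (Metric.closedBall_mem_nhds x (hδ0 x (huE hx)))⟩
  have hsub : E ⊆ ⋃ x ∈ u, Metric.closedBall x (5 * δ x) := fun x hx => by
    obtain ⟨y, hy, hxy⟩ := hcover x hx
    exact Set.mem_biUnion hy (hxy (Metric.mem_closedBall_self (hδ0 x hx).le))
  calc c * μ E ≤ c * ∑' x : u, K * μ (Metric.closedBall (x : X) (δ x)) := by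
        gcongr
        refine (measure_mono hsub).trans ((measure_biUnion_le μ hcount _).trans ?_)
        exact ENNReal.tsum_le_tsum fun x => hK x _ (hδ0 x (huE x.2))
    _ = K * ∑' x : u, c * μ (Metric.closedBall (x : X) (δ x)) := by
        rw [ENNReal.tsum_mul_left, ENNReal.tsum_mul_left, mul_left_comm]
    _ ≤ K * ∑' x : u, ∫⁻ y in Metric.closedBall (x : X) (δ x), φ y ∂μ := by
        gcongr with x
        exact hδ _ (huE x.2)
    _ = K * ∫⁻ y in ⋃ x ∈ u, Metric.closedBall x (δ x), φ y ∂μ := by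
        rw [lintegral_biUnion hcount (fun _ _ => Metric.isClosed_closedBall.measurableSet) hdisj]
    _ ≤ K * ∫⁻ y, φ y ∂μ := by
        gcongr
        exact Measure.restrict_le_self

lemma maximal_le_indicator_add (φ : X → ℝ≥0∞) (c : ℝ≥0∞) (x : X) :
    maximal μ φ x ≤ maximal μ ({y | c < φ y}.indicator φ) x + c := by
  refine iSup₂_le fun δ hδ => ?_
  calc (∫⁻ y in Metric.closedBall x δ, φ y ∂μ) / μ (Metric.closedBall x δ)
      ≤ (∫⁻ y in Metric.closedBall x δ, ({y | c < φ y}.indicator φ y + c) ∂μ)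
          / μ (Metric.closedBall x δ) := by
        gcongr with y
        by_cases hy : c < φ y
        · simp [Set.indicator, hy]
        · simp [Set.indicator, hy, not_lt.1 hy]
    _ = (∫⁻ y in Metric.closedBall x δ, {y | c < φ y}.indicator φ y ∂μ)
          / μ (Metric.closedBall x δ)
          + c * μ (Metric.closedBall x δ) / μ (Metric.closedBall x δ) := by
        rw [lintegral_add_right _ measurable_const, setLIntegral_const, ENNReal.add_div]
    _ ≤ maximal μ ({y | c < φ y}.indicator φ) x + c := by
        rw [mul_div_assoc]
        exact add_le_add (div_le_maximal hδ x)
          (mul_le_of_le_one_right' ENNReal.div_self_le_one)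

lemma mul_measure_lt_le_of_le_maximal [OpensMeasurableSpace X] [SecondCountableTopology X]
    [BoundedSpace X] {K : ℝ≥0∞}
    (hK : ∀ x δ, 0 < δ → μ (Metric.closedBall x (5 * δ)) ≤ K * μ (Metric.closedBall x δ))
    {G : X → ℝ≥0∞} (hle : ∀ x, G x ≤ maximal μ φ x) {c : ℝ≥0∞} (hc : c ≠ ∞) :
    c * μ {x | c < G x} ≤ 2 * K * ∫⁻ y, {y | c < 2 * φ y}.indicator φ y ∂μ := by
  have hhalf : {y | c < 2 * φ y} = {y | c / 2 < φ y} := by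
    ext y
    simp [ENNReal.div_lt_iff, mul_comm]
  have hsub : {x | c < G x} ⊆ {x | c / 2 < maximal μ ({y | c / 2 < φ y}.indicator φ) x} := by
    intro x hx
    have hlt := (hx.trans_le (hle x)).trans_le (maximal_le_indicator_add φ (c / 2) x)
    rw [← ENNReal.add_halves c] at hlt
    exact (ENNReal.add_lt_add_iff_right (ENNReal.div_ne_top hc two_ne_zero)).1
      (by simpa only [ENNReal.add_halves] using hlt)
  calc c * μ {x | c < G x}
      ≤ 2 * (c / 2 * μ {x | c / 2 < maximal μ ({y | c / 2 < φ y}.indicator φ) x}) := by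
        rw [← mul_assoc, ENNReal.mul_div_cancel two_ne_zero ENNReal.ofNat_ne_top]
        gcongr
    _ ≤ 2 * (K * ∫⁻ y, {y | c / 2 < φ y}.indicator φ y ∂μ) := by
        gcongr 2 * ?_
        exact mul_measure_lt_maximal_le hK _ _
    _ = 2 * K * ∫⁻ y, {y | c < 2 * φ y}.indicator φ y ∂μ := by rw [hhalf, mul_assoc]

lemma lintegral_sq_le_of_le_maximal [OpensMeasurableSpace X] [SecondCountableTopology X]
    [BoundedSpace X] [SFinite μ] {K : ℝ≥0∞}
    (hK : ∀ x δ, 0 < δ → μ (Metric.closedBall x (5 * δ)) ≤ K * μ (Metric.closedBall x δ))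
    {G : X → ℝ≥0∞} (hG : Measurable G) (hφ : Measurable φ) (hle : ∀ x, G x ≤ maximal μ φ x) :
    ∫⁻ x, G x ^ 2 ∂μ ≤ 8 * K * ∫⁻ x, φ x ^ 2 ∂μ := by
  have hset : MeasurableSet {p : ℝ × X | ENNReal.ofReal p.1 < 2 * φ p.2} :=
    measurableSet_lt (by fun_prop) (by fun_prop)
  have hmeas : Measurable
      ({p : ℝ × X | ENNReal.ofReal p.1 < 2 * φ p.2}.indicator fun p => φ p.2) :=
    Measurable.indicator (by fun_prop) hset
  have hinner (y : X) : ∫⁻ s in Set.Ioi (0 : ℝ),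
      {s | ENNReal.ofReal s < 2 * φ y}.indicator (fun _ => φ y) s = 2 * φ y ^ 2 := by
    have hlt : MeasurableSet {s : ℝ | ENNReal.ofReal s < 2 * φ y} :=
      measurableSet_lt ENNReal.measurable_ofReal measurable_const
    rw [lintegral_indicator_const hlt, Measure.restrict_apply hlt,
      volume_setOf_ofReal_lt_inter_Ioi, mul_left_comm, ← sq]
  calc ∫⁻ x, G x ^ 2 ∂μ
      = 2 * ∫⁻ s in Set.Ioi (0 : ℝ), ENNReal.ofReal s * μ {x | ENNReal.ofReal s < G x} :=
        lintegral_sq_eq_lintegral_measure_lt hG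
    _ ≤ 2 * ∫⁻ s in Set.Ioi (0 : ℝ), 2 * K * (∫⁻ y,
          {y | ENNReal.ofReal s < 2 * φ y}.indicator φ y ∂μ) := by
        gcongr 2 * ?_
        exact lintegral_mono fun s =>
          mul_measure_lt_le_of_le_maximal hK hle ENNReal.ofReal_ne_top
    _ = 2 * (2 * K * ∫⁻ y, (∫⁻ s in Set.Ioi (0 : ℝ),
          {s | ENNReal.ofReal s < 2 * φ y}.indicator (fun _ => φ y) s) ∂μ) := by
        have hswap := lintegral_lintegral_swap (μ := volume.restrict (Set.Ioi (0 : ℝ))) (ν := μ)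
          (f := fun s y => {p : ℝ × X | ENNReal.ofReal p.1 < 2 * φ p.2}.indicator
            (fun p => φ p.2) (s, y)) hmeas.aemeasurable
        congr 1
        refine (lintegral_const_mul _ hmeas.lintegral_prod_right').trans ?_
        rw [hswap]
        rfl
    _ = 8 * K * ∫⁻ x, φ x ^ 2 ∂μ := by
        simp only [hinner]
        rw [lintegral_const_mul' _ _ ENNReal.ofNat_ne_top]
        ring

end HardyLittlewood

section CircleMaximal

lemma arc_closedBall (t : Circ) (δ : ℝ) :
    arc (Metric.closedBall t δ) = ENNReal.ofReal (min 1 (δ / Real.pi)) := by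
  have hpi := Real.pi_pos
  have hvol := AddCircle.volume_closedBall (2 * Real.pi) (x := t) δ
  have hmin : ENNReal.ofReal (min (2 * Real.pi) (2 * δ))
      = ENNReal.ofReal (2 * Real.pi) * ENNReal.ofReal (min 1 (δ / Real.pi)) := by
    rw [← ENNReal.ofReal_mul (by positivity), mul_min_of_nonneg _ _ (by positivity)]
    congr 2
    · ring
    · field_simp
  rw [AddCircle.volume_eq_smul_haarAddCircle, Measure.smul_apply, smul_eq_mul, hmin] at hvol
  exact (ENNReal.mul_right_inj (by simpa using hpi) ENNReal.ofReal_ne_top).1 hvol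

lemma arc_closedBall_five_mul_le (t : Circ) (δ : ℝ) :
    arc (Metric.closedBall t (5 * δ)) ≤ 5 * arc (Metric.closedBall t δ) := by
  rw [arc_closedBall, arc_closedBall, ← ENNReal.ofReal_ofNat, ← ENNReal.ofReal_mul (by norm_num),
    mul_min_of_nonneg _ _ (by norm_num), mul_div_assoc]
  gcongr
  norm_num

lemma setLIntegral_closedBall_le (φ : Circ → ℝ≥0∞) (t : Circ) {δ : ℝ} (hδ : 0 < δ) :
    ∫⁻ τ in Metric.closedBall t δ, φ τ ∂arc ≤ maximal arc φ t * ENNReal.ofReal (δ / Real.pi) := by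
  have hpos : arc (Metric.closedBall t δ) ≠ 0 := by
    rw [arc_closedBall]
    exact (ENNReal.ofReal_pos.2 (lt_min one_pos (div_pos hδ Real.pi_pos))).ne'
  calc ∫⁻ τ in Metric.closedBall t δ, φ τ ∂arc
      ≤ maximal arc φ t * arc (Metric.closedBall t δ) :=
        (ENNReal.div_le_iff hpos (measure_ne_top _ _)).1 (div_le_maximal hδ t)
    _ ≤ maximal arc φ t * ENNReal.ofReal (δ / Real.pi) := by
        rw [arc_closedBall]
        gcongr
        exact min_le_right _ _

lemma exists_coe_eq_abs_eq_norm (x : Circ) :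
    ∃ y : ℝ, (y : Circ) = x ∧ |y| = ‖x‖ ∧ |y| ≤ Real.pi := by
  have hmem := (AddCircle.equivIoc (2 * Real.pi) (-Real.pi) x).2
  have hcoe : ((AddCircle.equivIoc (2 * Real.pi) (-Real.pi) x : ℝ) : Circ) = x :=
    (AddCircle.equivIoc (2 * Real.pi) (-Real.pi)).symm_apply_apply x
  set y : ℝ := (AddCircle.equivIoc (2 * Real.pi) (-Real.pi) x).1
  have hy : |y| ≤ Real.pi := abs_le.2 ⟨hmem.1.le, by linarith [hmem.2]⟩
  refine ⟨y, hcoe, ?_, hy⟩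
  rw [← hcoe, (AddCircle.norm_coe_eq_abs_iff _ Real.two_pi_pos.ne').2]
  rwa [abs_of_pos Real.two_pi_pos, mul_div_cancel_left₀ _ two_ne_zero]

lemma two_mul_norm_div_pi_le (x : Circ) : 2 * (‖x‖ / Real.pi) ≤ ‖1 - fourier 1 x‖ := by
  obtain ⟨y, rfl, hyx, hy⟩ := exists_coe_eq_abs_eq_norm x
  have hsin := Real.mul_abs_le_abs_sin (x := y / 2) (by rw [abs_div, abs_two]; linarith)
  rw [norm_sub_rev, fourier_coe_circ, Int.cast_one, mul_one,
    Complex.norm_exp_I_mul_ofReal_sub_one, norm_mul, Real.norm_ofNat, Real.norm_eq_abs, ← hyx]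
  calc 2 * (|y| / Real.pi) = 2 * (2 / Real.pi * |y / 2|) := by rw [abs_div, abs_two]; ring
    _ ≤ 2 * |Real.sin (y / 2)| := by gcongr

lemma norm_div_pi_le {r : ℝ} (h0 : 0 ≤ r) (h1 : r ≤ 1) (x : Circ) :
    ‖x‖ / Real.pi ≤ ‖1 - (r : ℂ) * fourier 1 x‖ := by
  have htri : ‖1 - fourier 1 x‖ ≤ ‖1 - (r : ℂ) * fourier 1 x‖ + (1 - r) := calc
    ‖1 - fourier 1 x‖
        = ‖(1 - (r : ℂ) * fourier 1 x) - ((1 - r : ℝ) : ℂ) * fourier 1 x‖ := by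
          push_cast; ring_nf
    _ ≤ ‖1 - (r : ℂ) * fourier 1 x‖ + (1 - r) := by
          refine (norm_sub_le _ _).trans_eq ?_
          rw [norm_mul_fourier (r := 1 - r) (by linarith)]
  linarith [two_mul_norm_div_pi_le x, one_sub_le_norm h0 x]

lemma poisson_le_of_le {r q : ℝ} (h1 : r < 1) (hq : 0 < q) {x : Circ}
    (h : q ≤ ‖1 - (r : ℂ) * fourier 1 x‖) : poisson r x ≤ 2 * (1 - r) / q ^ 2 :=
  div_le_div₀ (by linarith) (by nlinarith) (by positivity) (pow_le_pow_left₀ hq.le h 2)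

lemma exists_poisson_le {r : ℝ} (h0 : 0 ≤ r) (h1 : r < 1) (x : Circ) :
    ∃ k : ℕ, ‖x‖ ≤ 2 ^ k * (Real.pi * (1 - r)) ∧ poisson r x ≤ 8 / (4 ^ k * (1 - r)) := by
  have hd : 0 < 1 - r := by linarith
  have hpi := Real.pi_pos
  by_cases hx : ‖x‖ / (Real.pi * (1 - r)) < 1
  · refine ⟨0, by rw [div_lt_one (by positivity)] at hx; linarith,
      (poisson_le_of_le h1 hd (one_sub_le_norm h0 x)).trans ?_⟩
    rw [pow_zero, one_mul, div_le_div_iff₀ (by positivity) hd]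
    nlinarith [pow_pos hd 2]
  · obtain ⟨n, hn1, hn2⟩ := exists_nat_pow_near (not_lt.1 hx) one_lt_two
    rw [le_div_iff₀ (by positivity)] at hn1
    rw [div_lt_iff₀ (by positivity)] at hn2
    have hfar : 2 ^ n * (1 - r) ≤ ‖1 - (r : ℂ) * fourier 1 x‖ := by
      refine le_trans ?_ (norm_div_pi_le h0 h1.le x)
      rw [le_div_iff₀ hpi]
      linarith
    have hpow : (4 : ℝ) ^ (n + 1) = 4 * (2 ^ n) ^ 2 := by
      rw [pow_right_comm, pow_succ']
      norm_num
    refine ⟨n + 1, hn2.le, (poisson_le_of_le h1 (by positivity) hfar).trans_eq ?_⟩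
    rw [hpow]
    field_simp
    norm_num

lemma ofReal_mul_setLIntegral_closedBall_le {d : ℝ} (hd : 0 < d) (φ : Circ → ℝ≥0∞) (t : Circ)
    (k : ℕ) :
    ENNReal.ofReal (8 / (4 ^ k * d)) *
        ∫⁻ τ in Metric.closedBall t (2 ^ k * (Real.pi * d)), φ τ ∂arc ≤
      2⁻¹ ^ k * (8 * maximal arc φ t) := by
  have := Real.pi_pos
  have hradius : 8 / (4 ^ k * d) * (2 ^ k * (Real.pi * d) / Real.pi) = (2⁻¹ : ℝ) ^ k * 8 := by
    rw [show (4 : ℝ) = 2 * 2 by norm_num, mul_pow, inv_pow]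
    field_simp
  calc ENNReal.ofReal (8 / (4 ^ k * d)) *
        ∫⁻ τ in Metric.closedBall t (2 ^ k * (Real.pi * d)), φ τ ∂arc
      ≤ ENNReal.ofReal (8 / (4 ^ k * d)) *
          (maximal arc φ t * ENNReal.ofReal (2 ^ k * (Real.pi * d) / Real.pi)) := by
        gcongr
        exact setLIntegral_closedBall_le φ t (by positivity)
    _ = ENNReal.ofReal ((2⁻¹ : ℝ) ^ k * 8) * maximal arc φ t := by
        rw [← hradius, ENNReal.ofReal_mul (p := 8 / (4 ^ k * d)) (by positivity), mul_assoc,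
          mul_comm (maximal arc φ t)]
    _ = 2⁻¹ ^ k * (8 * maximal arc φ t) := by
        rw [ENNReal.ofReal_mul (by positivity), ENNReal.ofReal_pow (by positivity),
          ENNReal.ofReal_inv_of_pos two_pos, ENNReal.ofReal_ofNat, ENNReal.ofReal_ofNat, mul_assoc]

lemma lintegral_poisson_mul_le_maximal {r : ℝ} (h0 : 0 ≤ r) (h1 : r < 1) {φ : Circ → ℝ≥0∞}
    (hφ : Measurable φ) (t : Circ) :
    ∫⁻ τ, ENNReal.ofReal (poisson r (t - τ)) * φ τ ∂arc ≤ 16 * maximal arc φ t := by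
  set B : ℕ → Set Circ := fun k => Metric.closedBall t (2 ^ k * (Real.pi * (1 - r)))
  have hB (k) : MeasurableSet (B k) := Metric.isClosed_closedBall.measurableSet
  have hdyadic (τ) : ENNReal.ofReal (poisson r (t - τ)) * φ τ
      ≤ ∑' k : ℕ, ENNReal.ofReal (8 / (4 ^ k * (1 - r))) * (B k).indicator φ τ := by
    obtain ⟨k, hk, hle⟩ := exists_poisson_le h0 h1 (t - τ)
    refine le_trans ?_ (ENNReal.le_tsum k)
    rw [Set.indicator_of_mem (by rwa [Metric.mem_closedBall, dist_comm, dist_eq_norm])]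
    gcongr
  calc ∫⁻ τ, ENNReal.ofReal (poisson r (t - τ)) * φ τ ∂arc
      ≤ ∫⁻ τ, ∑' k : ℕ, ENNReal.ofReal (8 / (4 ^ k * (1 - r))) * (B k).indicator φ τ ∂arc :=
        lintegral_mono hdyadic
    _ = ∑' k : ℕ, ENNReal.ofReal (8 / (4 ^ k * (1 - r))) * ∫⁻ τ in B k, φ τ ∂arc := by
        rw [lintegral_tsum fun k => ((hφ.indicator (hB k)).const_mul _).aemeasurable]
        simp only [lintegral_const_mul' _ _ ENNReal.ofReal_ne_top, lintegral_indicator (hB _)]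
    _ ≤ ∑' k : ℕ, (2⁻¹ : ℝ≥0∞) ^ k * (8 * maximal arc φ t) :=
        ENNReal.tsum_le_tsum (ofReal_mul_setLIntegral_closedBall_le (by linarith) φ t)
    _ = 16 * maximal arc φ t := by
        rw [ENNReal.tsum_mul_right, ENNReal.tsum_geometric, ENNReal.one_sub_inv_two, inv_inv,
          ← mul_assoc]
        norm_num

end CircleMaximal

section RadialSup

/-- The supremum of `‖g r‖` over the radii `0 < r < s`; for `s = 1` it is the radial maximal
function. -/
def radialSup (s : ℝ) (g : ℝ → ℂ) : ℝ≥0∞ := ⨆ r ∈ Set.Ioo 0 s, ‖g r‖ₑ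

/-- The norm of `U` in the Hardy space `h¹`: the supremum of its `L¹` means over the circles of
radius `s < 1`. -/
def hardyNorm (U : ℝ → Circ → ℂ) : ℝ≥0∞ := ⨆ s ∈ Set.Ioo (0 : ℝ) 1, ∫⁻ t, ‖U s t‖ₑ ∂arc

lemma le_radialSup (g : ℝ → ℂ) {s r : ℝ} (hr : r ∈ Set.Ioo 0 s) : ‖g r‖ₑ ≤ radialSup s g :=
  le_iSup₂ (f := fun r (_ : r ∈ Set.Ioo 0 s) => ‖g r‖ₑ) r hr

lemma le_hardyNorm (U : ℝ → Circ → ℂ) {s : ℝ} (hs : s ∈ Set.Ioo (0 : ℝ) 1) :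
    ∫⁻ t, ‖U s t‖ₑ ∂arc ≤ hardyNorm U :=
  le_iSup₂ (f := fun s (_ : s ∈ Set.Ioo (0 : ℝ) 1) => ∫⁻ t, ‖U s t‖ₑ ∂arc) s hs

lemma radialSup_mono (g : ℝ → ℂ) : Monotone fun s => radialSup s g := fun _ _ h =>
  biSup_mono fun _ hr => ⟨hr.1, hr.2.trans_le h⟩

lemma iSup_radialSup (g : ℝ → ℂ) {s : ℕ → ℝ} (hs : ∀ n, s n ≤ 1)
    (hlim : Tendsto s atTop (𝓝 1)) : ⨆ n, radialSup (s n) g = radialSup 1 g := by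
  refine le_antisymm (iSup_le fun n => radialSup_mono g (hs n)) (iSup₂_le fun r hr => ?_)
  obtain ⟨n, hn⟩ := (hlim.eventually (lt_mem_nhds hr.2)).exists
  exact le_iSup_of_le n (le_radialSup g ⟨hr.1, hn⟩)

lemma measurable_radialSup {X : Type*} [TopologicalSpace X] [MeasurableSpace X]
    [OpensMeasurableSpace X] {U : ℝ → X → ℂ} {s : ℝ} (hU : ∀ r ∈ Set.Ioo 0 s, Continuous (U r)) :
    Measurable fun x => radialSup s fun r => U r x :=
  (lowerSemicontinuous_biSup fun r hr => (hU r hr).enorm.lowerSemicontinuous).measurable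

lemma exists_seq_mem_Ioo_tendsto_one :
    ∃ s : ℕ → ℝ, Monotone s ∧ (∀ n, s n ∈ Set.Ioo (0 : ℝ) 1) ∧ Tendsto s atTop (𝓝 1) := by
  obtain ⟨s, hmono, hmem, hlim⟩ := exists_seq_strictMono_tendsto' (zero_lt_one (α := ℝ))
  exact ⟨s, hmono.monotone, hmem, hlim⟩

lemma radialSup_pint_le_maximal {g : Circ → ℂ} (hg : Measurable g) (t : Circ) :
    radialSup 1 (fun r => pint r g t) ≤ 16 * maximal arc (fun τ => ‖g τ‖ₑ) t :=
  iSup₂_le fun _ hr => (enorm_pint_le hr.1.le hr.2 g t).trans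
    (lintegral_poisson_mul_le_maximal hr.1.le hr.2 hg.enorm t)

lemma IsPoissonFamily.radialSup_le {U : ℝ → Circ → ℂ} (hU : IsPoissonFamily U) {s : ℝ}
    (hs : s < 1) (t : Circ) :
    radialSup s (fun r => U r t) ≤ radialSup 1 fun r => pint r (U s) t :=
  iSup₂_le fun _ hr => (congrArg enorm (hU.eq_pint hr.1 hr.2 hs t)).trans_le <|
    le_radialSup (fun r => pint r (U s) t)
      ⟨div_pos hr.1 (hr.1.trans hr.2), (div_lt_one (hr.1.trans hr.2)).2 hr.2⟩

lemma IsPoissonFamily.monotoneOn_lintegral_enorm {U : ℝ → Circ → ℂ} (hU : IsPoissonFamily U) :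
    MonotoneOn (fun r => ∫⁻ t, ‖U r t‖ₑ ∂arc) (Set.Ioo 0 1) := by
  intro r hr s hs hrs
  rcases hrs.eq_or_lt with rfl | hrs
  · rfl
  · simp only [hU.eq_pint hr.1 hrs hs.2]
    exact lintegral_enorm_pint_le (div_pos hr.1 hs.1).le ((div_lt_one hs.1).2 hrs)
      (hU.continuous s hs).measurable

lemma IsPoissonFamily.hardyNorm_eq_iSup {U : ℝ → Circ → ℂ} (hU : IsPoissonFamily U) {s : ℕ → ℝ}
    (hs : ∀ n, s n ∈ Set.Ioo (0 : ℝ) 1) (hlim : Tendsto s atTop (𝓝 1)) :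
    hardyNorm U = ⨆ n, ∫⁻ t, ‖U (s n) t‖ₑ ∂arc := by
  refine le_antisymm (iSup₂_le fun r hr => ?_) (iSup_le fun n => le_hardyNorm U (hs n))
  obtain ⟨n, hn⟩ := (hlim.eventually (lt_mem_nhds hr.2)).exists
  exact le_iSup_of_le n (hU.monotoneOn_lintegral_enorm hr (hs n) hn.le)

lemma mul_arc_lt_radialSup_le {U : ℝ → Circ → ℂ} (hU : IsPoissonFamily U) (c : ℝ≥0∞) :
    c * arc {t | c < radialSup 1 fun r => U r t} ≤ 80 * hardyNorm U := by
  obtain ⟨s, hmono, hs, hlim⟩ := exists_seq_mem_Ioo_tendsto_one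
  have hunion : {t | c < radialSup 1 fun r => U r t}
      = ⋃ n, {t | c < radialSup (s n) fun r => U r t} := by
    ext t
    simp [← iSup_radialSup _ (fun n => (hs n).2.le) hlim, lt_iSup_iff]
  have hincr : Monotone fun n => {t | c < radialSup (s n) fun r => U r t} := fun _ _ h t ht =>
    lt_of_lt_of_le ht (radialSup_mono _ (hmono h))
  rw [hunion, hincr.measure_iUnion, ENNReal.mul_iSup]
  refine iSup_le fun n => ?_
  calc c * arc {t | c < radialSup (s n) fun r => U r t}
      ≤ c * arc {t | c / 16 < maximal arc (fun τ => ‖U (s n) τ‖ₑ) t} := by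
        gcongr c * arc ?_
        exact fun t (ht : c < _) => ENNReal.div_lt_of_lt_mul' <|
          ht.trans_le <| (hU.radialSup_le (hs n).2 t).trans <|
            radialSup_pint_le_maximal (hU.continuous _ (hs n)).measurable t
    _ = 16 * (c / 16 * arc {t | c / 16 < maximal arc (fun τ => ‖U (s n) τ‖ₑ) t}) := by
        rw [← mul_assoc, ENNReal.mul_div_cancel (by norm_num) (by norm_num)]
    _ ≤ 16 * (5 * ∫⁻ τ, ‖U (s n) τ‖ₑ ∂arc) := by
        gcongr 16 * ?_
        exact mul_measure_lt_maximal_le (fun t δ _ => arc_closedBall_five_mul_le t δ) _ _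
    _ ≤ 80 * hardyNorm U := by
        rw [← mul_assoc]
        norm_num
        gcongr
        exact le_hardyNorm U (hs n)

end RadialSup

section SquareRoot

/-- The analytic function `h` is a square root of an outer majorant of `p`: `|h|² ≥ |p|` on the
closed unit disc, with equality on the unit circle. The modulus of `p ^ (1/2)` is thereby compared
with that of an analytic function although `p` may vanish in the disc. -/
structure IsOuterSqrt (p h : ℂ → ℂ) : Prop where
  diffContOnCl : DiffContOnCl ℂ h (Metric.ball 0 1)
  norm_le : ∀ z, ‖z‖ ≤ 1 → ‖p z‖ ≤ ‖h z ^ 2‖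
  norm_eq : ∀ z, ‖z‖ = 1 → ‖p z‖ = ‖h z ^ 2‖

lemma IsOuterSqrt.mul {p q h k : ℂ → ℂ} (hp : IsOuterSqrt p h) (hq : IsOuterSqrt q k) :
    IsOuterSqrt (fun z => p z * q z) (fun z => h z * k z) where
  diffContOnCl := hp.diffContOnCl.smul hq.diffContOnCl
  norm_le z hz := by
    rw [mul_pow, norm_mul, norm_mul]
    exact mul_le_mul (hp.norm_le z hz) (hq.norm_le z hz) (norm_nonneg _) (norm_nonneg _)
  norm_eq z hz := by rw [mul_pow, norm_mul, norm_mul, hp.norm_eq z hz, hq.norm_eq z hz]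

lemma isOuterSqrt_const (c : ℂ) :
    IsOuterSqrt (fun _ => c) fun _ => c ^ ((2 : ℕ) : ℂ)⁻¹ := by
  refine ⟨diffContOnCl_const, fun _ _ => ?_, fun _ _ => ?_⟩ <;>
  rw [Complex.cpow_nat_inv_pow c two_ne_zero]

lemma diffContOnCl_sqrt_one_sub {b : ℂ} (hb : ‖b‖ ≤ 1) :
    DiffContOnCl ℂ (fun z => (1 - b * z) ^ ((2 : ℕ) : ℂ)⁻¹) (Metric.ball 0 1) := by
  have hre (z : ℂ) : 1 - ‖z‖ ≤ (1 - b * z).re := by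
    have hmul : ‖b * z‖ ≤ ‖z‖ := by
      rw [norm_mul]
      exact mul_le_of_le_one_left (norm_nonneg _) hb
    simp only [Complex.sub_re, Complex.one_re]
    linarith [Complex.re_le_norm (b * z)]
  constructor
  · refine DifferentiableOn.cpow_const (by fun_prop) fun z hz => Or.inl ?_
    linarith [hre z, mem_ball_zero_iff.1 hz]
  · rw [closure_ball _ one_ne_zero]
    intro z hz
    have hcont : ContinuousAt (fun x : ℂ => x ^ ((2 : ℕ) : ℂ)⁻¹) (1 - b * z) := by
      refine Complex.continuousAt_cpow_const_of_re_pos (Or.inl ?_) (by norm_num)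
      linarith [hre z, mem_closedBall_zero_iff.1 hz]
    exact (ContinuousAt.comp (f := fun z : ℂ => 1 - b * z) hcont
      (by fun_prop)).continuousWithinAt

lemma norm_one_sub_conj_mul_sq_sub (a z : ℂ) :
    ‖1 - (starRingEnd ℂ) a * z‖ ^ 2 - ‖z - a‖ ^ 2 = (1 - ‖a‖ ^ 2) * (1 - ‖z‖ ^ 2) := by
  simp only [← Complex.normSq_eq_norm_sq, Complex.normSq_apply, Complex.sub_re, Complex.sub_im,
    Complex.mul_re, Complex.mul_im, Complex.conj_re, Complex.conj_im, Complex.one_re,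
    Complex.one_im]
  ring

/-- A root in the open disc is reflected in the unit circle. -/
lemma isOuterSqrt_sub_of_norm_lt_one {a : ℂ} (ha : ‖a‖ < 1) :
    IsOuterSqrt (fun z => z - a) fun z => (1 - (starRingEnd ℂ) a * z) ^ ((2 : ℕ) : ℂ)⁻¹ where
  diffContOnCl := diffContOnCl_sqrt_one_sub (by rw [RCLike.norm_conj]; exact ha.le)
  norm_le z hz := by
    rw [Complex.cpow_nat_inv_pow _ two_ne_zero]
    refine (sq_le_sq₀ (norm_nonneg _) (norm_nonneg _)).1 (sub_nonneg.1 ?_)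
    rw [norm_one_sub_conj_mul_sq_sub]
    exact mul_nonneg (sub_nonneg.2 (pow_le_one₀ (norm_nonneg _) ha.le))
      (sub_nonneg.2 (pow_le_one₀ (norm_nonneg _) hz))
  norm_eq z hz := by
    rw [Complex.cpow_nat_inv_pow _ two_ne_zero]
    refine ((sq_eq_sq₀ (norm_nonneg _) (norm_nonneg _)).1 (sub_eq_zero.1 ?_)).symm
    rw [norm_one_sub_conj_mul_sq_sub, hz, one_pow, sub_self, mul_zero]

lemma exists_isOuterSqrt_sub (a : ℂ) : ∃ h, IsOuterSqrt (fun z => z - a) h := by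
  rcases lt_or_ge ‖a‖ 1 with ha | ha
  · exact ⟨_, isOuterSqrt_sub_of_norm_lt_one ha⟩
  · have ha0 : a ≠ 0 := norm_pos_iff.1 (by linarith)
    have hunit : IsOuterSqrt (fun z => 1 - a⁻¹ * z)
        fun z => (1 - a⁻¹ * z) ^ ((2 : ℕ) : ℂ)⁻¹ := by
      refine ⟨diffContOnCl_sqrt_one_sub (by rw [norm_inv]; exact inv_le_one_of_one_le₀ ha),
        fun z _ => ?_, fun z _ => ?_⟩ <;>
      rw [Complex.cpow_nat_inv_pow _ two_ne_zero]
    have hfactor : (fun z => z - a) = fun z => -a * (1 - a⁻¹ * z) := by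
      funext z
      field_simp
      ring
    rw [hfactor]
    exact ⟨_, (isOuterSqrt_const (-a)).mul hunit⟩

lemma exists_isOuterSqrt_eval (p : Polynomial ℂ) : ∃ h, IsOuterSqrt (fun z => p.eval z) h := by
  have hroots (m : Multiset ℂ) : ∃ h, IsOuterSqrt
      (fun z => ((m.map fun a => Polynomial.X - Polynomial.C a).prod).eval z) h := by
    induction m using Multiset.induction_on with
    | empty => simpa using ⟨_, isOuterSqrt_const 1⟩
    | cons a m ih =>
      obtain ⟨h, hh⟩ := ih
      obtain ⟨k, hk⟩ := exists_isOuterSqrt_sub a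
      exact ⟨fun z => k z * h z, by simpa using hk.mul hh⟩
  obtain ⟨h, hh⟩ := hroots p.roots
  rw [(IsAlgClosed.splits p).eq_prod_roots]
  simp only [Polynomial.eval_mul, Polynomial.eval_C]
  exact ⟨_, (isOuterSqrt_const p.leadingCoeff).mul hh⟩

lemma sqrt_enorm_eval_le (p : Polynomial ℂ) {r : ℝ} (h0 : 0 ≤ r) (h1 : r < 1) (t : Circ) :
    ‖p.eval (r * fourier 1 t)‖ₑ ^ (2⁻¹ : ℝ) ≤
      ∫⁻ τ, ENNReal.ofReal (poisson r (t - τ)) * ‖p.eval (fourier 1 τ)‖ₑ ^ (2⁻¹ : ℝ) ∂arc := by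
  obtain ⟨h, hh⟩ := exists_isOuterSqrt_eval p
  have hsqrt (z : ℂ) : ‖h z ^ 2‖ₑ ^ (2⁻¹ : ℝ) = ‖h z‖ₑ := by
    rw [enorm_pow]
    exact_mod_cast ENNReal.pow_rpow_inv_natCast two_ne_zero ‖h z‖ₑ
  have hcircle (τ : Circ) : ‖p.eval (fourier 1 τ)‖ₑ ^ (2⁻¹ : ℝ) = ‖h (fourier 1 τ)‖ₑ := by
    rw [← hsqrt, enorm_eq_iff_norm_eq.2 (hh.norm_eq _ (norm_fourier_apply _ _))]
  calc ‖p.eval (r * fourier 1 t)‖ₑ ^ (2⁻¹ : ℝ)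
      ≤ ‖h (r * fourier 1 t) ^ 2‖ₑ ^ (2⁻¹ : ℝ) := by
        gcongr
        exact enorm_le_iff_norm_le.2 (hh.norm_le _ (by rw [norm_mul_fourier h0]; exact h1.le))
    _ = ‖pint r (fun τ => h (fourier 1 τ)) t‖ₑ := by
        rw [hsqrt, pint_of_diffContOnCl hh.diffContOnCl h0 h1]
    _ ≤ _ := by
        simpa only [hcircle] using enorm_pint_le h0 h1 (fun τ => h (fourier 1 τ)) t

lemma exists_polynomial_tendstoUniformlyOn {F : ℂ → ℂ} {R s : ℝ}
    (hF : DifferentiableOn ℂ F (Metric.ball 0 R)) (h0 : 0 ≤ s) (hs : s < R) :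
    ∃ P : ℕ → Polynomial ℂ,
      TendstoUniformlyOn (fun n z => (P n).eval z) F atTop (Metric.closedBall 0 s) := by
  obtain ⟨a, hsa, haR⟩ := exists_between hs
  obtain ⟨b, hab, hbR⟩ := exists_between haR
  lift a to ℝ≥0 using h0.trans hsa.le
  lift b to ℝ≥0 using a.2.trans hab.le
  have hseries := (hF.mono (Metric.closedBall_subset_ball hbR)).hasFPowerSeriesOnBall
    (NNReal.coe_pos.1 (a.2.trans_lt hab))
  refine ⟨fun n => ∑ k ∈ Finset.range n,
    Polynomial.C ((cauchyPowerSeries F 0 b).coeff k) * Polynomial.X ^ k, ?_⟩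
  have hlim := (hseries.tendstoUniformlyOn (ENNReal.coe_lt_coe.2 hab)).mono
    (Metric.closedBall_subset_ball hsa)
  simpa only [FormalMultilinearSeries.partialSum, FormalMultilinearSeries.apply_eq_pow_smul_coeff,
    smul_eq_mul, zero_add, Polynomial.eval_finsetSum, Polynomial.eval_mul, Polynomial.eval_C,
    Polynomial.eval_pow, Polynomial.eval_X, mul_comm] using hlim

lemma tendsto_lintegral_poisson_mul {r : ℝ} (h0 : 0 ≤ r) (h1 : r < 1) (t : Circ)
    {f : ℕ → Circ → ℝ≥0∞} {g : Circ → ℝ≥0∞} {C : ℝ≥0∞} (hC : C ≠ ∞)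
    (hf : ∀ n, Measurable (f n)) (hle : ∀ᶠ n in atTop, ∀ τ, f n τ ≤ C)
    (hlim : ∀ τ, Tendsto (fun n => f n τ) atTop (𝓝 (g τ))) :
    Tendsto (fun n => ∫⁻ τ, ENNReal.ofReal (poisson r (t - τ)) * f n τ ∂arc) atTop
      (𝓝 (∫⁻ τ, ENNReal.ofReal (poisson r (t - τ)) * g τ ∂arc)) := by
  have hpoisson : Measurable fun τ => ENNReal.ofReal (poisson r (t - τ)) :=
    (((continuous_poisson h0 h1).comp (by fun_prop)).measurable).ennreal_ofReal
  refine tendsto_lintegral_filter_of_dominated_convergence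
    (fun τ => ENNReal.ofReal (poisson r (t - τ)) * C) (.of_forall fun n => hpoisson.mul (hf n))
    (hle.mono fun n hn => .of_forall fun τ => by gcongr; exact hn τ) ?_
    (.of_forall fun τ => ENNReal.Tendsto.const_mul (hlim τ) (.inr ENNReal.ofReal_ne_top))
  rwa [lintegral_mul_const' _ _ hC,
    lintegral_sub_left_eq_self (μ := arc) (fun τ => ENNReal.ofReal (poisson r τ)) t,
    lintegral_poisson h0 h1, one_mul]

lemma sqrt_enorm_le_lintegral_poisson {F : ℂ → ℂ} (hF : DifferentiableOn ℂ F (Metric.ball 0 1))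
    {r s : ℝ} (h0 : 0 < r) (hrs : r < s) (h1 : s < 1) (t : Circ) :
    ‖F (r * fourier 1 t)‖ₑ ^ (2⁻¹ : ℝ) ≤ ∫⁻ τ, ENNReal.ofReal (poisson (r / s) (t - τ)) *
      ‖F (s * fourier 1 τ)‖ₑ ^ (2⁻¹ : ℝ) ∂arc := by
  have hs0 : 0 < s := h0.trans hrs
  have hq0 : 0 ≤ r / s := (div_pos h0 hs0).le
  have hq1 : r / s < 1 := (div_lt_one hs0).2 hrs
  have hmem {q : ℝ} (hq : 0 ≤ q) (hqs : q ≤ s) (τ : Circ) :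
      (q : ℂ) * fourier 1 τ ∈ Metric.closedBall (0 : ℂ) s := by
    rwa [mem_closedBall_zero_iff, norm_mul_fourier hq]
  obtain ⟨P, hP⟩ := exists_polynomial_tendstoUniformlyOn hF hs0.le h1
  obtain ⟨B, hB⟩ := (isCompact_closedBall (0 : ℂ) s).exists_bound_of_continuousOn
    (hF.continuousOn.mono (Metric.closedBall_subset_ball h1))
  have hle (n : ℕ) : ‖(P n).eval (r * fourier 1 t)‖ₑ ^ (2⁻¹ : ℝ) ≤
      ∫⁻ τ, ENNReal.ofReal (poisson (r / s) (t - τ)) *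
        ‖(P n).eval (s * fourier 1 τ)‖ₑ ^ (2⁻¹ : ℝ) ∂arc := by
    have hcomp := sqrt_enorm_eval_le ((P n).comp (Polynomial.C (s : ℂ) * Polynomial.X)) hq0 hq1 t
    simpa only [Polynomial.eval_comp, Polynomial.eval_mul, Polynomial.eval_C, Polynomial.eval_X,
      ← mul_assoc, Complex.ofReal_div,
      mul_div_cancel₀ _ (Complex.ofReal_ne_zero.2 hs0.ne')] using hcomp
  have hsqrt {z : ℂ} (hz : z ∈ Metric.closedBall (0 : ℂ) s) :
      Tendsto (fun n => ‖(P n).eval z‖ₑ ^ (2⁻¹ : ℝ)) atTop (𝓝 (‖F z‖ₑ ^ (2⁻¹ : ℝ))) :=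
    (ENNReal.continuous_rpow_const.tendsto _).comp (hP.tendsto_at hz).enorm
  refine le_of_tendsto_of_tendsto' (hsqrt (hmem h0.le hrs.le t))
    (tendsto_lintegral_poisson_mul hq0 hq1 t (C := ENNReal.ofReal (B + 1) ^ (2⁻¹ : ℝ))
      (by finiteness) (fun n => Continuous.measurable (by fun_prop)) ?_
      fun τ => hsqrt (hmem hs0.le le_rfl τ)) hle
  filter_upwards [Metric.tendstoUniformlyOn_iff.1 hP 1 one_pos] with n hn τ
  have hz := hmem hs0.le le_rfl τ
  rw [← ofReal_norm]
  gcongr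
  calc ‖(P n).eval (s * fourier 1 τ)‖
      ≤ ‖F (s * fourier 1 τ)‖ + ‖F (s * fourier 1 τ) - (P n).eval (s * fourier 1 τ)‖ :=
        norm_le_norm_add_norm_sub _ _
    _ ≤ B + 1 := add_le_add (hB _ hz) (by simpa only [dist_eq_norm] using (hn _ hz).le)

lemma radialSup_le_sq_maximal {F : ℂ → ℂ} (hF : DifferentiableOn ℂ F (Metric.ball 0 1)) {s : ℝ}
    (h1 : s < 1) (t : Circ) :
    radialSup s (fun r => F (r * fourier 1 t)) ≤
      (16 * maximal arc (fun τ => ‖F (s * fourier 1 τ)‖ₑ ^ (2⁻¹ : ℝ)) t) ^ 2 := by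
  refine iSup₂_le fun r hr => ?_
  have hs0 : 0 < s := hr.1.trans hr.2
  have hmeas : Measurable fun τ : Circ => ‖F (s * fourier 1 τ)‖ₑ ^ (2⁻¹ : ℝ) :=
    ((isPoissonFamily_of_differentiableOn hF).continuous s ⟨hs0, h1⟩).measurable.enorm.pow_const _
  rw [← ENNReal.rpow_ofNat, ← ENNReal.rpow_inv_le_iff two_pos]
  exact (sqrt_enorm_le_lintegral_poisson hF hr.1 hr.2 h1 t).trans
    (lintegral_poisson_mul_le_maximal (div_pos hr.1 hs0).le ((div_lt_one hs0).2 hr.2) hmeas t)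

lemma lintegral_radialSup_le_of_lt_one {F : ℂ → ℂ} (hF : DifferentiableOn ℂ F (Metric.ball 0 1))
    {s : ℝ} (hs : s ∈ Set.Ioo (0 : ℝ) 1) :
    ∫⁻ t, radialSup s (fun r => F (r * fourier 1 t)) ∂arc ≤
      10240 * ∫⁻ t, ‖F (s * fourier 1 t)‖ₑ ∂arc := by
  have hU := isPoissonFamily_of_differentiableOn hF
  have hmeas : Measurable fun t => radialSup s fun r => F (r * fourier 1 t) :=
    measurable_radialSup fun r hr => hU.continuous r ⟨hr.1, hr.2.trans hs.2⟩
  have hsq (x : ℝ≥0∞) : (x ^ (2⁻¹ : ℝ)) ^ 2 = x := by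
    exact_mod_cast ENNReal.rpow_inv_natCast_pow two_ne_zero x
  have hle (t : Circ) : radialSup s (fun r => F (r * fourier 1 t)) ^ (2⁻¹ : ℝ) / 16 ≤
      maximal arc (fun τ => ‖F (s * fourier 1 τ)‖ₑ ^ (2⁻¹ : ℝ)) t := by
    refine ENNReal.div_le_of_le_mul' ((ENNReal.rpow_inv_le_iff two_pos).2 ?_)
    rw [ENNReal.rpow_ofNat]
    exact radialSup_le_sq_maximal hF hs.2 t
  have hmax := lintegral_sq_le_of_le_maximal (fun t δ _ => arc_closedBall_five_mul_le t δ)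
    ((hmeas.pow_const _).div_const 16)
    ((hU.continuous s hs).measurable.enorm.pow_const (2⁻¹ : ℝ)) hle
  calc ∫⁻ t, radialSup s (fun r => F (r * fourier 1 t)) ∂arc
      = 256 * ∫⁻ t, (radialSup s (fun r => F (r * fourier 1 t)) ^ (2⁻¹ : ℝ) / 16) ^ 2 ∂arc := by
        rw [← lintegral_const_mul' _ _ (by norm_num)]
        refine lintegral_congr fun t => ?_
        rw [show (256 : ℝ≥0∞) = 16 ^ 2 by norm_num, ← mul_pow,
          ENNReal.mul_div_cancel (by norm_num) (by norm_num), hsq]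
    _ ≤ 256 * (8 * 5 * ∫⁻ t, (‖F (s * fourier 1 t)‖ₑ ^ (2⁻¹ : ℝ)) ^ 2 ∂arc) := by gcongr
    _ = 10240 * ∫⁻ t, ‖F (s * fourier 1 t)‖ₑ ∂arc := by
        simp only [hsq]
        rw [← mul_assoc]
        norm_num

lemma lintegral_radialSup_le {F : ℂ → ℂ} (hF : DifferentiableOn ℂ F (Metric.ball 0 1)) :
    ∫⁻ t, radialSup 1 (fun r => F (r * fourier 1 t)) ∂arc ≤
      10240 * hardyNorm fun r t => F (r * fourier 1 t) := by
  obtain ⟨s, hmono, hs, hlim⟩ := exists_seq_mem_Ioo_tendsto_one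
  have hU := isPoissonFamily_of_differentiableOn hF
  calc ∫⁻ t, radialSup 1 (fun r => F (r * fourier 1 t)) ∂arc
      = ⨆ n, ∫⁻ t, radialSup (s n) (fun r => F (r * fourier 1 t)) ∂arc := by
        rw [← lintegral_iSup (fun n => measurable_radialSup fun r hr =>
          hU.continuous r ⟨hr.1, hr.2.trans (hs n).2⟩) fun _ _ h t => radialSup_mono _ (hmono h)]
        simp only [iSup_radialSup _ (fun n => (hs n).2.le) hlim]
    _ ≤ 10240 * hardyNorm fun r t => F (r * fourier 1 t) :=
        iSup_le fun n => (lintegral_radialSup_le_of_lt_one hF (hs n)).trans <| by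
          gcongr
          exact le_hardyNorm (fun r t => F (r * fourier 1 t)) (hs n)

end SquareRoot

section FourierCoefficients

variable {F : Circ → ℂ}

lemma norm_fourierCoeff_le (F : Circ → ℂ) (n : ℤ) : ‖fourierCoeff F n‖ ≤ ∫ t, ‖F t‖ ∂arc := by
  refine (norm_integral_le_integral_norm _).trans_eq ?_
  simp only [smul_eq_mul, norm_mul, norm_fourier_apply, one_mul]

lemma hasSum_sq_fourierCoeff_of_continuous (hF : Continuous F) :
    HasSum (fun n => ‖fourierCoeff F n‖ ^ 2) (∫ t, ‖F t‖ ^ 2 ∂arc) := by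
  have hmem : MemLp F 2 arc := hF.memLp_of_hasCompactSupport (.of_compactSpace F)
  have hparseval := hasSum_sq_fourierCoeff (hmem.toLp F)
  rw [fourierCoeff_congr_ae hmem.coeFn_toLp] at hparseval
  convert hparseval using 1
  exact integral_congr_ae (hmem.coeFn_toLp.mono fun t ht => by simp only [ht])

lemma fourierCoeff_of_hasSum {b : ℤ → ℂ} (hb : Summable fun n => ‖b n‖)
    (hF : ∀ t, HasSum (fun n => b n * fourier n t) (F t)) (m : ℤ) : fourierCoeff F m = b m := by
  have hsum := hasSum_integral_of_norm_le (μ := arc)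
    (F := fun n t => fourier (-m) t * (b n * fourier n t))
    (fun n => Continuous.aestronglyMeasurable (by fun_prop)) hb
    (fun n t => by simp only [norm_mul, norm_fourier_apply, mul_one, one_mul, le_refl])
    fun t => (hF t).mul_left _
  simp only [mul_left_comm _ (b _), ← fourier_add, integral_const_mul, integral_fourier,
    neg_add_eq_zero] at hsum
  refine HasSum.unique hsum ?_
  convert! hasSum_ite_eq m (b m) using 2 with n
  split_ifs with hmn hnm hnm
  · rw [hmn, mul_one]
  · exact absurd hmn.symm hnm
  · exact absurd hnm.symm hmn
  · rw [mul_zero]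

lemma fourierCoeff_sub {G : Circ → ℂ} (hF : Continuous F) (hG : Continuous G) (n : ℤ) :
    fourierCoeff (F - G) n = fourierCoeff F n - fourierCoeff G n := by
  simp only [fourierCoeff, smul_eq_mul, Pi.sub_apply, mul_sub]
  exact integral_sub (integrable_of_continuous (by fun_prop))
    (integrable_of_continuous (by fun_prop))

lemma fourierCoeff_ofReal_neg (f : Circ → ℝ) (n : ℤ) :
    fourierCoeff (fun t => (f t : ℂ)) (-n)
      = starRingEnd ℂ (fourierCoeff (fun t => (f t : ℂ)) n) := by
  rw [fourierCoeff, fourierCoeff, ← integral_conj]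
  simp only [smul_eq_mul, map_mul, Complex.conj_ofReal, ← fourier_neg]

variable {r : ℝ}

lemma hasSum_pint_fourierCoeff (h0 : 0 ≤ r) (h1 : r < 1) (hF : Continuous F) (t : Circ) :
    HasSum (fun n : ℤ => fourierCoeff F n * ((r : ℂ) ^ n.natAbs * fourier n t)) (pint r F t) := by
  obtain ⟨B, hB⟩ := isCompact_univ.exists_bound_of_continuousOn hF.continuousOn
  have hsum := hasSum_integral_of_norm_le (μ := arc)
    (F := fun (n : ℤ) τ => (r : ℂ) ^ n.natAbs * fourier n (t - τ) * F τ)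
    (u := fun n => r ^ n.natAbs * B) (fun n => Continuous.aestronglyMeasurable (by fun_prop))
    ((hasSum_pow_natAbs h0 h1).summable.mul_right B) (fun n τ => ?_)
    fun τ => (hasSum_poisson h0 h1 (t - τ)).mul_right (F τ)
  · convert! hsum using 2 with n
    rw [mul_comm, fourierCoeff, ← integral_const_mul]
    refine integral_congr_ae (.of_forall fun τ => ?_)
    simp only [sub_eq_add_neg, fourier_add_arg, fourier_neg_arg, smul_eq_mul, mul_assoc]
  · rw [norm_mul, norm_mul, norm_fourier_apply, mul_one, norm_pow, Complex.norm_of_nonneg h0]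
    gcongr
    exact hB τ (Set.mem_univ τ)

lemma summable_norm_mul_pow_natAbs {c : ℤ → ℂ} {A : ℝ} (hc : ∀ n, ‖c n‖ ≤ A) (h0 : 0 ≤ r)
    (h1 : r < 1) : Summable fun n : ℤ => ‖c n‖ * r ^ n.natAbs :=
  .of_nonneg_of_le (fun n => by positivity)
    (fun n => mul_le_mul_of_nonneg_right (hc n) (by positivity))
    ((hasSum_pow_natAbs h0 h1).summable.mul_left A)

lemma fourierCoeff_pint (h0 : 0 ≤ r) (h1 : r < 1) (hF : Continuous F) (n : ℤ) :
    fourierCoeff (pint r F) n = fourierCoeff F n * (r : ℂ) ^ n.natAbs := by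
  refine fourierCoeff_of_hasSum (b := fun n => fourierCoeff F n * (r : ℂ) ^ n.natAbs) ?_
    (fun t => by simpa only [mul_assoc] using hasSum_pint_fourierCoeff h0 h1 hF t) n
  simp only [norm_mul, norm_pow, Complex.norm_of_nonneg h0]
  exact summable_norm_mul_pow_natAbs (norm_fourierCoeff_le F) h0 h1

end FourierCoefficients

lemma mul_mem_Ioo_zero_one {ρ r : ℝ} (hρ : ρ ∈ Set.Ioo (0 : ℝ) 1)
    (hr : r ∈ Set.Ioc (0 : ℝ) 1) : ρ * r ∈ Set.Ioo (0 : ℝ) 1 :=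
  ⟨mul_pos hρ.1 hr.1, mul_lt_one_of_nonneg_of_lt_one_left hρ.1.le hρ.2 hr.2⟩

/-- The Fourier coefficients of the boundary distribution of a Poisson family `U`: the coefficients
`c n` such that `U r t = ∑ n, c n * r ^ |n| * e^{int}`, read off on the circle of radius `1 / 2`. -/
def boundaryCoeff (U : ℝ → Circ → ℂ) (n : ℤ) : ℂ := fourierCoeff (U (1 / 2)) n * 2 ^ n.natAbs

namespace IsPoissonFamily

variable {U V : ℝ → Circ → ℂ}

lemma clm_comp (hU : IsPoissonFamily U) (L : ℂ →L[ℝ] ℂ) :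
    IsPoissonFamily fun r t => L (U r t) where
  continuous r hr := L.continuous.comp (hU.continuous r hr)
  continuousOn_radius t := L.continuous.comp_continuousOn (hU.continuousOn_radius t)
  eq_pint r s h0 hrs h1 t := by
    have hs0 := h0.trans hrs
    have hcont := continuous_poisson (div_pos h0 hs0).le ((div_lt_one hs0).2 hrs)
    have hUs := hU.continuous s ⟨hs0, h1⟩
    rw [hU.eq_pint h0 hrs h1 t, pint,
      ← L.integral_comp_comm (integrable_of_continuous (by fun_prop)), pint]
    simp only [← Complex.real_smul, map_smul]

lemma add (hU : IsPoissonFamily U) (hV : IsPoissonFamily V) :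
    IsPoissonFamily fun r t => U r t + V r t where
  continuous r hr := (hU.continuous r hr).add (hV.continuous r hr)
  continuousOn_radius t := (hU.continuousOn_radius t).add (hV.continuousOn_radius t)
  eq_pint r s h0 hrs h1 t := by
    have hs0 := h0.trans hrs
    have hs : s ∈ Set.Ioo (0 : ℝ) 1 := ⟨hs0, h1⟩
    rw [hU.eq_pint h0 hrs h1 t, hV.eq_pint h0 hrs h1 t, ← pint_add (div_pos h0 hs0).le
      ((div_lt_one hs0).2 hrs) (hU.continuous s hs) (hV.continuous s hs)]

lemma sub (hU : IsPoissonFamily U) (hV : IsPoissonFamily V) :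
    IsPoissonFamily fun r t => U r t - V r t := by
  simpa [sub_eq_add_neg] using hU.add (hV.clm_comp (-.id ℝ ℂ))

lemma dilate (hU : IsPoissonFamily U) {ρ : ℝ} (hρ : ρ ∈ Set.Ioo (0 : ℝ) 1) :
    IsPoissonFamily fun r => U (ρ * r) where
  continuous r hr := hU.continuous _ (mul_mem_Ioo_zero_one hρ ⟨hr.1, hr.2.le⟩)
  continuousOn_radius t := (hU.continuousOn_radius t).comp
    (Continuous.continuousOn (by fun_prop)) fun r hr => mul_mem_Ioo_zero_one hρ ⟨hr.1, hr.2.le⟩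
  eq_pint r s h0 hrs h1 t := by
    rw [hU.eq_pint (mul_pos hρ.1 h0) (mul_lt_mul_of_pos_left hrs hρ.1)
      (mul_mem_Ioo_zero_one hρ ⟨h0.trans hrs, h1.le⟩).2, mul_div_mul_left _ _ hρ.1.ne']

lemma tendsto_dilate (hU : IsPoissonFamily U) {ρ : ℝ} (hρ : ρ ∈ Set.Ioo (0 : ℝ) 1) (t : Circ) :
    Tendsto (fun r => U (ρ * r) t) (𝓝[<] 1) (𝓝 (U ρ t)) := by
  have hmul : Tendsto (fun r => ρ * r) (𝓝[<] 1) (𝓝 ρ) := by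
    simpa using (tendsto_id.mono_left nhdsWithin_le_nhds : Tendsto id (𝓝[<] (1 : ℝ)) _).const_mul ρ
  exact ((hU.continuousOn_radius t).continuousAt (isOpen_Ioo.mem_nhds hρ)).tendsto.comp hmul

lemma fourierCoeff_mul_pow (hU : IsPoissonFamily U) {r s : ℝ} (h0 : 0 < r) (hrs : r < s)
    (h1 : s < 1) (n : ℤ) :
    fourierCoeff (U r) n * (s : ℂ) ^ n.natAbs = fourierCoeff (U s) n * (r : ℂ) ^ n.natAbs := by
  have hs0 := h0.trans hrs
  rw [funext (hU.eq_pint h0 hrs h1), fourierCoeff_pint (div_pos h0 hs0).le ((div_lt_one hs0).2 hrs)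
    (hU.continuous s ⟨hs0, h1⟩), mul_assoc, ← mul_pow, Complex.ofReal_div,
    div_mul_cancel₀ _ (Complex.ofReal_ne_zero.2 hs0.ne')]

variable {r : ℝ}

lemma fourierCoeff_eq (hU : IsPoissonFamily U) (hr : r ∈ Set.Ioo (0 : ℝ) 1) (n : ℤ) :
    fourierCoeff (U r) n = boundaryCoeff U n * (r : ℂ) ^ n.natAbs := by
  have hcross : fourierCoeff (U r) n * ((1 / 2 : ℝ) : ℂ) ^ n.natAbs
      = fourierCoeff (U (1 / 2)) n * (r : ℂ) ^ n.natAbs := by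
    rcases lt_trichotomy r (1 / 2) with h | rfl | h
    · exact hU.fourierCoeff_mul_pow hr.1 h (by norm_num) n
    · rfl
    · exact (hU.fourierCoeff_mul_pow (by norm_num) h hr.2 n).symm
  rw [boundaryCoeff, mul_right_comm, ← hcross, mul_assoc, ← mul_pow]
  norm_num

lemma hasSum (hU : IsPoissonFamily U) (hr : r ∈ Set.Ioo (0 : ℝ) 1) (t : Circ) :
    HasSum (fun n => boundaryCoeff U n * ((r : ℂ) ^ n.natAbs * fourier n t)) (U r t) := by
  obtain ⟨s, hrs, hs1⟩ := exists_between hr.2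
  have hs : s ∈ Set.Ioo (0 : ℝ) 1 := ⟨hr.1.trans hrs, hs1⟩
  rw [hU.eq_pint hr.1 hrs hs1 t]
  convert! hasSum_pint_fourierCoeff (div_pos hr.1 hs.1).le ((div_lt_one hs.1).2 hrs)
    (hU.continuous s hs) t using 2 with n
  rw [hU.fourierCoeff_eq hs, ← mul_assoc (_ * _), mul_assoc (boundaryCoeff U n), ← mul_pow,
    Complex.ofReal_div, mul_div_cancel₀ _ (Complex.ofReal_ne_zero.2 hs.1.ne'), mul_assoc]

end IsPoissonFamily

section RadialLimits

/-- The function `g` of the radius has a finite limit at `1` from the left. -/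
def HasRadialLimit (g : ℝ → ℂ) : Prop := ∃ L, Tendsto g (𝓝[<] 1) (𝓝 L)

lemma eventually_mem_Ioo_zero_one : ∀ᶠ r in 𝓝[<] (1 : ℝ), r ∈ Set.Ioo (0 : ℝ) 1 :=
  Ioo_mem_nhdsLT one_pos

lemma hasRadialLimit_of_radialSup_sub_le {g : ℝ → ℂ} (happrox : ∀ ε : ℝ, 0 < ε →
    ∃ h, HasRadialLimit h ∧ radialSup 1 (fun r => g r - h r) ≤ ENNReal.ofReal ε) :
    HasRadialLimit g := by
  refine cauchy_map_iff_exists_tendsto.1 (Metric.cauchy_iff.2 ⟨inferInstance, fun ε hε => ?_⟩)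
  obtain ⟨h, ⟨L, hL⟩, hle⟩ := happrox (ε / 5) (by positivity)
  have hclose : ∀ r ∈ Set.Ioo (0 : ℝ) 1, dist (h r) L < ε / 5 → dist (g r) L < 2 * (ε / 5) := by
    intro r hr hrL
    have hgh := (le_radialSup (fun r => g r - h r) hr).trans hle
    rw [← edist_eq_enorm_sub, edist_le_ofReal (by positivity)] at hgh
    linarith [dist_triangle (g r) (h r) L]
  refine ⟨g '' {r | r ∈ Set.Ioo (0 : ℝ) 1 ∧ dist (h r) L < ε / 5}, image_mem_map
    (eventually_mem_Ioo_zero_one.and (hL (Metric.ball_mem_nhds L (by positivity)))), ?_⟩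
  rintro _ ⟨r, ⟨hr, hrL⟩, rfl⟩ _ ⟨r', ⟨hr', hrL'⟩, rfl⟩
  linarith [dist_triangle_right (g r) (g r') L, hclose r hr hrL, hclose r' hr' hrL']

variable {U : ℝ → Circ → ℂ}

lemma ae_hasRadialLimit_of_tendsto_hardyNorm (hU : IsPoissonFamily U)
    (hdil : Tendsto (fun ρ => hardyNorm fun r t => U r t - U (ρ * r) t) (𝓝[<] 1) (𝓝 0)) :
    ∀ᵐ t ∂arc, HasRadialLimit fun r => U r t := by
  have hae : ∀ ε : ℝ≥0∞, ε ≠ 0 → ε ≠ ∞ → ∀ᵐ t ∂arc, ∃ ρ ∈ Set.Ioo (0 : ℝ) 1,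
      radialSup 1 (fun r => U r t - U (ρ * r) t) ≤ ε := by
    intro ε hε0 hε
    have hlim := ENNReal.Tendsto.div_const
      (ENNReal.Tendsto.const_mul (a := 80) hdil (.inr (by norm_num))) (.inr hε0)
    rw [mul_zero, ENNReal.zero_div] at hlim
    refine le_antisymm (ge_of_tendsto hlim (eventually_mem_Ioo_zero_one.mono fun ρ hρ => ?_))
      zero_le
    rw [ENNReal.le_div_iff_mul_le (.inl hε0) (.inl hε), mul_comm]
    refine le_trans ?_ (mul_arc_lt_radialSup_le (hU.sub (hU.dilate hρ)) ε)
    gcongr ε * arc ?_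
    exact fun t ht => not_le.1 fun hle => ht ⟨ρ, hρ, hle⟩
  have hae' : ∀ᵐ t ∂arc, ∀ m : ℕ, ∃ ρ ∈ Set.Ioo (0 : ℝ) 1,
      radialSup 1 (fun r => U r t - U (ρ * r) t) ≤ ENNReal.ofReal (1 / (m + 1)) :=
    ae_all_iff.2 fun m => hae _ (ENNReal.ofReal_pos.2 (by positivity)).ne' ENNReal.ofReal_ne_top
  filter_upwards [hae'] with t ht
  refine hasRadialLimit_of_radialSup_sub_le fun ε hε => ?_
  obtain ⟨m, hm⟩ := exists_nat_one_div_lt hε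
  obtain ⟨ρ, hρ, hle⟩ := ht m
  exact ⟨_, ⟨_, hU.tendsto_dilate hρ t⟩, hle.trans (ENNReal.ofReal_le_ofReal hm.le)⟩

lemma lintegral_enorm_le_sqrt_integral_sq {F : Circ → ℂ} (hF : Continuous F) :
    ∫⁻ t, ‖F t‖ₑ ∂arc ≤ ENNReal.ofReal √(∫ t, ‖F t‖ ^ 2 ∂arc) := by
  rw [← ofReal_integral_norm_eq_lintegral_enorm (integrable_of_continuous hF)]
  exact ENNReal.ofReal_le_ofReal <| Real.le_sqrt_of_sq_le <|
    (even_two.convexOn_pow (𝕜 := ℝ)).map_integral_le (by fun_prop) isClosed_univ (by simp)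
      (integrable_of_continuous (by fun_prop)) (integrable_of_continuous (by fun_prop))

lemma hardyNorm_sub_dilate_le (hU : IsPoissonFamily U)
    (hc : Summable fun n => ‖boundaryCoeff U n‖ ^ 2) {ρ : ℝ} (hρ : ρ ∈ Set.Ioo (0 : ℝ) 1) :
    hardyNorm (fun r t => U r t - U (ρ * r) t)
      ≤ ENNReal.ofReal √(∑' n, (‖boundaryCoeff U n‖ * (1 - ρ ^ n.natAbs)) ^ 2) := by
  have hpow (n : ℤ) : 0 ≤ 1 - ρ ^ n.natAbs := sub_nonneg.2 (pow_le_one₀ hρ.1.le hρ.2.le)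
  refine iSup₂_le fun s hs => ?_
  have hρs := mul_mem_Ioo_zero_one hρ ⟨hs.1, hs.2.le⟩
  have hcont := (hU.continuous s hs).sub (hU.continuous _ hρs)
  refine (lintegral_enorm_le_sqrt_integral_sq hcont).trans ?_
  have hcoeff (n : ℤ) : fourierCoeff (U s - U (ρ * s)) n
      = boundaryCoeff U n * (1 - (ρ : ℂ) ^ n.natAbs) * (s : ℂ) ^ n.natAbs := by
    rw [fourierCoeff_sub (hU.continuous s hs) (hU.continuous _ hρs), hU.fourierCoeff_eq hs,
      hU.fourierCoeff_eq hρs, Complex.ofReal_mul, mul_pow]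
    ring
  have hparseval := hasSum_sq_fourierCoeff_of_continuous hcont
  rw [← hparseval.tsum_eq]
  gcongr with n
  · exact hparseval.summable
  · refine .of_nonneg_of_le (fun n => by positivity) (fun n => ?_) hc
    have := hpow n
    gcongr
    exact mul_le_of_le_one_right (norm_nonneg (boundaryCoeff U n))
      (sub_le_self _ (pow_nonneg hρ.1.le _))
  · rw [hcoeff, norm_mul, norm_mul, norm_pow, Complex.norm_of_nonneg hs.1.le, ← Complex.ofReal_pow,
      ← Complex.ofReal_one, ← Complex.ofReal_sub, Complex.norm_of_nonneg (hpow n)]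
    exact mul_le_of_le_one_right (mul_nonneg (norm_nonneg _) (hpow n))
      (pow_le_one₀ hs.1.le hs.2.le)

lemma ae_hasRadialLimit_of_summable_sq (hU : IsPoissonFamily U)
    (hc : Summable fun n => ‖boundaryCoeff U n‖ ^ 2) :
    ∀ᵐ t ∂arc, HasRadialLimit fun r => U r t := by
  refine ae_hasRadialLimit_of_tendsto_hardyNorm hU ?_
  have hlim : Tendsto (fun ρ : ℝ => ∑' n : ℤ, (‖boundaryCoeff U n‖ * (1 - ρ ^ n.natAbs)) ^ 2)
      (𝓝[<] 1) (𝓝 (∑' n : ℤ, (‖boundaryCoeff U n‖ * (1 - 1 ^ n.natAbs)) ^ 2)) := by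
    refine tendsto_tsum_of_dominated_convergence hc (fun n => ?_) ?_
    · exact (Continuous.tendsto (by fun_prop) (1 : ℝ)).mono_left nhdsWithin_le_nhds
    · filter_upwards [eventually_mem_Ioo_zero_one] with ρ hρ n
      have hpow := pow_le_one₀ hρ.1.le hρ.2.le (n := n.natAbs)
      have : 0 ≤ 1 - ρ ^ n.natAbs := sub_nonneg.2 hpow
      rw [Real.norm_of_nonneg (by positivity)]
      gcongr
      exact mul_le_of_le_one_right (norm_nonneg (boundaryCoeff U n))
        (sub_le_self _ (pow_nonneg hρ.1.le _))
  have hsqrt := ENNReal.tendsto_ofReal hlim.sqrt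
  simp only [one_pow, sub_self, mul_zero, ne_eq, OfNat.ofNat_ne_zero, not_false_eq_true, zero_pow,
    tsum_zero, Real.sqrt_zero, ENNReal.ofReal_zero] at hsqrt
  exact tendsto_of_tendsto_of_tendsto_of_le_of_le' tendsto_const_nhds hsqrt
    (.of_forall fun _ => zero_le)
    (eventually_mem_Ioo_zero_one.mono fun ρ hρ => hardyNorm_sub_dilate_le hU hc hρ)

lemma summable_sq_boundaryCoeff (hU : IsPoissonFamily U) {C : ℝ}
    (hC : ∀ s ∈ Set.Ioo (0 : ℝ) 1, ∫ t, ‖U s t‖ ^ 2 ∂arc ≤ C) :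
    Summable fun n => ‖boundaryCoeff U n‖ ^ 2 := by
  refine summable_of_sum_le (c := C) (fun n => by positivity) fun S => ?_
  have hlim : Tendsto (fun r : ℝ => ∑ n ∈ S, ‖boundaryCoeff U n * (r : ℂ) ^ n.natAbs‖ ^ 2) (𝓝[<] 1)
      (𝓝 (∑ n ∈ S, ‖boundaryCoeff U n * ((1 : ℝ) : ℂ) ^ n.natAbs‖ ^ 2)) :=
    (Continuous.tendsto (by fun_prop) (1 : ℝ)).mono_left nhdsWithin_le_nhds
  simp only [Complex.ofReal_one, one_pow, mul_one] at hlim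
  refine le_of_tendsto hlim (eventually_mem_Ioo_zero_one.mono fun r hr => ?_)
  have hparseval := hasSum_sq_fourierCoeff_of_continuous (hU.continuous r hr)
  simp only [hU.fourierCoeff_eq hr] at hparseval
  exact (sum_le_hasSum S (fun n _ => by positivity) hparseval).trans (hC r hr)

end RadialLimits

section AnalyticCompletion

/-- The analytic function on the disc whose real part at `r e^{it}` is
`∑ n, c n * r ^ |n| * e^{int}`, when the latter is real. -/
def analyticCompletion (c : ℤ → ℂ) (z : ℂ) : ℂ := ∑' n : ℕ, 2 * c n * z ^ n - c 0

variable {c : ℤ → ℂ}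

lemma differentiableOn_analyticCompletion
    (hc : ∀ r ∈ Set.Ioo (0 : ℝ) 1, Summable fun n : ℕ => ‖2 * c n‖ * r ^ n) :
    DifferentiableOn ℂ (analyticCompletion c) (Metric.ball 0 1) := by
  refine DifferentiableOn.sub_const (fun z hz => ?_) _
  obtain ⟨r, hzr, hr1⟩ := exists_between (mem_ball_zero_iff.1 hz)
  have hsum := Complex.differentiableOn_tsum_of_summable_norm (U := Metric.ball (0 : ℂ) r)
    (F := fun (n : ℕ) z => 2 * c n * z ^ n) (hc r ⟨(norm_nonneg z).trans_lt hzr, hr1⟩)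
    (fun n => by fun_prop) Metric.isOpen_ball fun n w hw => by
      rw [norm_mul, norm_pow]
      gcongr
      exact (mem_ball_zero_iff.1 hw).le
  exact (hsum.differentiableAt
    (Metric.isOpen_ball.mem_nhds (mem_ball_zero_iff.2 hzr))).differentiableWithinAt

variable {V : ℝ → Circ → ℝ}

lemma summable_norm_two_mul_boundaryCoeff {U : ℝ → Circ → ℂ} (hU : IsPoissonFamily U) {r : ℝ}
    (hr : r ∈ Set.Ioo (0 : ℝ) 1) : Summable fun n : ℕ => ‖2 * boundaryCoeff U n‖ * r ^ n := by
  have hsum := ((hU.hasSum hr 0).summable.norm.comp_injective Nat.cast_injective).mul_left 2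
  convert! hsum using 2 with n
  simp [abs_of_pos hr.1, mul_assoc]

lemma re_analyticCompletion (hV : IsPoissonFamily fun r t => (V r t : ℂ)) {r : ℝ}
    (hr : r ∈ Set.Ioo (0 : ℝ) 1) (t : Circ) :
    (analyticCompletion (boundaryCoeff fun r t => (V r t : ℂ)) (r * fourier 1 t)).re = V r t := by
  set c := boundaryCoeff fun r t => (V r t : ℂ) with hc
  set z := (r : ℂ) * fourier 1 t with hz
  have hconj (n : ℤ) : c (-n) = starRingEnd ℂ (c n) := by
    simp only [hc, boundaryCoeff, fourierCoeff_ofReal_neg, Int.natAbs_neg, map_mul, map_pow,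
      Complex.conj_ofNat]
  have hpair (n : ℕ) : c n * ((r : ℂ) ^ (n : ℤ).natAbs * fourier n t)
      + c (-n) * ((r : ℂ) ^ (-(n : ℤ)).natAbs * fourier (-n) t) = ((2 * c n * z ^ n).re : ℂ) := by
    rw [Int.natAbs_neg, Int.natAbs_natCast, hconj, fourier_neg, fourier_natCast, hz, mul_pow,
      mul_assoc 2, ← Complex.conj_ofReal r, ← map_pow, ← map_mul, ← map_mul, map_pow,
      Complex.conj_ofReal, Complex.add_conj]
    simp
  have hc0 : ((c 0).re : ℂ) = c 0 := Complex.conj_eq_iff_re.1 (by simpa using (hconj 0).symm)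
  have hsummable : Summable fun n : ℕ => 2 * c n * z ^ n := by
    refine .of_norm ?_
    simpa only [norm_mul _ (_ ^ _), norm_pow, hz, norm_mul_fourier hr.1.le] using
      summable_norm_two_mul_boundaryCoeff hV hr
  have hsum := (hV.hasSum hr t).nat_add_neg
  simp only [← hc, hpair] at hsum
  have hre := hsum.unique (Complex.hasSum_ofReal.2 (Complex.hasSum_re hsummable.hasSum))
  simp only [Int.natAbs_zero, pow_zero, fourier_zero, mul_one] at hre
  rw [← hc0] at hre
  rw [analyticCompletion, Complex.sub_re, sub_eq_iff_eq_add]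
  exact_mod_cast hre.symm

end AnalyticCompletion

section Fatou

variable {U : ℝ → Circ → ℂ} {V : ℝ → Circ → ℝ}

lemma ae_ne_top_of_mul_measure_lt_le {X : Type*} [MeasurableSpace X] {μ : Measure X} {M : X → ℝ≥0∞}
    {K : ℝ≥0∞} (hK : K ≠ ∞) (hM : ∀ b : ℝ≥0∞, b * μ {x | b < M x} ≤ K) : ∀ᵐ x ∂μ, M x ≠ ∞ := by
  rw [ae_iff]
  by_contra hne
  obtain ⟨n, hn⟩ := ENNReal.exists_nat_mul_gt hne hK
  refine (hn.trans_le (le_trans ?_ (hM n))).false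
  gcongr with x
  exact fun hx => (not_not.1 hx) ▸ ENNReal.natCast_lt_top n

lemma hardyNorm_ne_top_of_nonneg (hV : IsPoissonFamily fun r t => (V r t : ℂ))
    (hpos : ∀ r ∈ Set.Ioo (0 : ℝ) 1, ∀ t, 0 ≤ V r t) :
    hardyNorm (fun r t => (V r t : ℂ)) ≠ ∞ := by
  refine ne_top_of_le_ne_top ENNReal.ofReal_ne_top (iSup₂_le (a := ENNReal.ofReal
    (boundaryCoeff (fun r t => (V r t : ℂ)) 0).re) fun s hs => ?_)
  have hmean := hV.fourierCoeff_eq hs 0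
  simp only [fourierCoeff, neg_zero, fourier_zero, one_smul, Int.natAbs_zero, pow_zero, mul_one,
    integral_complex_ofReal] at hmean
  rw [← hmean, Complex.ofReal_re, ← ofReal_integral_norm_eq_lintegral_enorm
    (integrable_of_continuous (hV.continuous s hs))]
  simp only [Complex.norm_of_nonneg (hpos s hs _), le_refl]

lemma ae_hasRadialLimit_of_nonneg (hV : IsPoissonFamily fun r t => (V r t : ℂ))
    (hpos : ∀ r ∈ Set.Ioo (0 : ℝ) 1, ∀ t, 0 ≤ V r t) :
    ∀ᵐ t ∂arc, HasRadialLimit fun r => (V r t : ℂ) := by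
  set F := analyticCompletion (boundaryCoeff fun r t => (V r t : ℂ)) with hF
  have hre : ∀ r ∈ Set.Ioo (0 : ℝ) 1, ∀ t,
      ‖Complex.exp (-F (r * fourier 1 t))‖ = Real.exp (-V r t) :=
    fun r hr t => by rw [Complex.norm_exp, Complex.neg_re, hF, re_analyticCompletion hV hr]
  -- `exp (-F)` is bounded, so Fatou's theorem for square integrable functions applies to it.
  have hexp : IsPoissonFamily fun r t => Complex.exp (-F (r * fourier 1 t)) :=
    isPoissonFamily_of_differentiableOn (F := fun z => Complex.exp (-F z))
      (differentiableOn_analyticCompletion fun r hr =>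
        summable_norm_two_mul_boundaryCoeff hV hr).neg.cexp
  have hexp_limit := ae_hasRadialLimit_of_summable_sq hexp <|
    summable_sq_boundaryCoeff hexp (C := 1) fun s hs => by
      simp only [hre s hs]
      refine (integral_mono_of_nonneg (.of_forall fun t => by positivity) (integrable_const 1)
        (.of_forall fun t => ?_)).trans_eq (by simp)
      exact pow_le_one₀ (Real.exp_pos _).le (Real.exp_le_one_iff.2 (neg_nonpos.2 (hpos s hs t)))
  have hbdd := ae_ne_top_of_mul_measure_lt_le
    (ENNReal.mul_ne_top (by norm_num) (hardyNorm_ne_top_of_nonneg hV hpos))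
    (mul_arc_lt_radialSup_le hV)
  filter_upwards [hexp_limit, hbdd] with t ⟨L, hL⟩ hM
  set M := (radialSup 1 fun r => (V r t : ℂ)).toReal
  have hle : ∀ r ∈ Set.Ioo (0 : ℝ) 1, V r t ≤ M := by
    intro r hr
    have h := ENNReal.toReal_mono hM (le_radialSup (fun r => (V r t : ℂ)) hr)
    rwa [toReal_enorm, Complex.norm_of_nonneg (hpos r hr t)] at h
  have hnorm : Tendsto (fun r => Real.exp (-V r t)) (𝓝[<] 1) (𝓝 ‖L‖) :=
    hL.norm.congr' (eventually_mem_Ioo_zero_one.mono fun r hr => hre r hr t)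
  have hL0 : 0 < ‖L‖ := (Real.exp_pos (-M)).trans_le <| ge_of_tendsto hnorm <|
    eventually_mem_Ioo_zero_one.mono fun r hr => Real.exp_le_exp.2 (neg_le_neg (hle r hr))
  have hlog := (hnorm.log hL0.ne').neg
  simp only [Real.log_exp, neg_neg] at hlog
  exact ⟨_, (Complex.continuous_ofReal.tendsto _).comp hlog⟩

lemma norm_pint_le {r : ℝ} (h0 : 0 ≤ r) (h1 : r < 1) (F : Circ → ℂ) (t : Circ) :
    ‖pint r F t‖ ≤ (pint r (fun τ => (‖F τ‖ : ℂ)) t).re := by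
  simp only [pint, ← Complex.ofReal_mul, integral_complex_ofReal, Complex.ofReal_re]
  refine (norm_integral_le_integral_norm _).trans_eq (integral_congr_ae (.of_forall fun τ => ?_))
  simp only [norm_mul, Complex.norm_of_nonneg (poisson_nonneg h0 h1 _)]

lemma exists_tendsto_ultrafilter_fourierCoeff {ι : Type*} (𝒰 : Ultrafilter ι) {W : ι → Circ → ℂ}
    {A : ℝ} (hA : ∀ᶠ i in 𝒰, ∫ t, ‖W i t‖ ∂arc ≤ A) (n : ℤ) :
    ∃ v : ℂ, ‖v‖ ≤ A ∧ Tendsto (fun i => fourierCoeff (W i) n) 𝒰 (𝓝 v) := by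
  have hmem : Metric.closedBall (0 : ℂ) A ∈ 𝒰.map fun i => fourierCoeff (W i) n :=
    hA.mono fun i hi => mem_closedBall_zero_iff.2 ((norm_fourierCoeff_le _ n).trans hi)
  obtain ⟨v, hv, hlim⟩ := (isCompact_closedBall (0 : ℂ) A).ultrafilter_le_nhds' _ hmem
  exact ⟨v, mem_closedBall_zero_iff.1 hv, hlim⟩

lemma exists_isPoissonFamily_tendsto_pint {ι : Type*} (𝒰 : Ultrafilter ι) {W : ι → Circ → ℂ}
    {A : ℝ} (hW : ∀ᶠ i in 𝒰, Continuous (W i)) (hA : ∀ᶠ i in 𝒰, ∫ t, ‖W i t‖ ∂arc ≤ A) :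
    ∃ P : ℝ → Circ → ℂ, IsPoissonFamily P ∧
      ∀ r ∈ Set.Ioo (0 : ℝ) 1, ∀ t, Tendsto (fun i => pint r (W i) t) 𝒰 (𝓝 (P r t)) := by
  choose v hvA hv using exists_tendsto_ultrafilter_fourierCoeff 𝒰 hA
  have hnorm {r : ℝ} (hr : 0 ≤ r) {b : ℂ} (hb : ‖b‖ ≤ A) (n : ℤ) (t : Circ) :
      ‖b * ((r : ℂ) ^ n.natAbs * fourier n t)‖ ≤ A * r ^ n.natAbs := by
    rw [norm_mul, norm_mul, norm_fourier_apply, mul_one, norm_pow, Complex.norm_of_nonneg hr]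
    gcongr
  have hsummable {r : ℝ} (hr : r ∈ Set.Ioo (0 : ℝ) 1) : Summable fun n : ℤ => A * r ^ n.natAbs :=
    (hasSum_pow_natAbs hr.1.le hr.2).summable.mul_left A
  refine ⟨fun r t => ∑' n : ℤ, v n * ((r : ℂ) ^ n.natAbs * fourier n t), isPoissonFamily_of_hasSum
    (fun r hr => summable_norm_mul_pow_natAbs hvA hr.1.le hr.2) fun r hr t =>
      (Summable.of_norm_bounded (hsummable hr) fun n => hnorm hr.1.le (hvA n) n t).hasSum,
    fun r hr t => ?_⟩
  refine (tendsto_tsum_of_dominated_convergence (hsummable hr) (fun n => (hv n).mul_const _)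
    (hA.mono fun i hi n => hnorm hr.1.le ((norm_fourierCoeff_le _ n).trans hi) n t)).congr'
    (hW.mono fun i hi => (hasSum_pint_fourierCoeff hr.1.le hr.2 hi t).tsum_eq)

/-- The majorant is a weak limit of the Poisson integrals of `‖U s‖` as `s → 1`. -/
lemma exists_isPoissonFamily_norm_le (hU : IsPoissonFamily U) (hfin : hardyNorm U ≠ ∞) :
    ∃ V : ℝ → Circ → ℝ, IsPoissonFamily (fun r t => (V r t : ℂ)) ∧
      ∀ r ∈ Set.Ioo (0 : ℝ) 1, ∀ t, ‖U r t‖ ≤ V r t := by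
  obtain ⟨𝒰, h𝒰⟩ : ∃ 𝒰 : Ultrafilter ℝ, (𝒰 : Filter ℝ) ≤ 𝓝[<] 1 := Ultrafilter.exists_le _
  have hevent : ∀ᶠ s in (𝒰 : Filter ℝ), s ∈ Set.Ioo (0 : ℝ) 1 := h𝒰 eventually_mem_Ioo_zero_one
  have hmean : ∀ s ∈ Set.Ioo (0 : ℝ) 1, ∫ t, ‖(‖U s t‖ : ℂ)‖ ∂arc ≤ (hardyNorm U).toReal := by
    intro s hs
    have hle := ENNReal.toReal_mono hfin (le_hardyNorm U hs)
    rw [← ofReal_integral_norm_eq_lintegral_enorm (integrable_of_continuous (hU.continuous s hs)),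
      ENNReal.toReal_ofReal (integral_nonneg fun _ => norm_nonneg _)] at hle
    simpa using hle
  obtain ⟨P, hP, hlim⟩ := exists_isPoissonFamily_tendsto_pint 𝒰
    (W := fun s t => (‖U s t‖ : ℂ)) (hevent.mono fun s hs => by
      have := hU.continuous s hs
      fun_prop) (hevent.mono hmean)
  refine ⟨fun r t => (P r t).re, hP.clm_comp (Complex.ofRealCLM.comp Complex.reCLM),
    fun r hr t => le_of_tendsto_of_tendsto ((hU.tendsto_dilate hr t).mono_left h𝒰).norm
      ((Complex.continuous_re.tendsto _).comp (hlim r hr t)) (hevent.mono fun s hs => ?_)⟩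
  have hpint := hU.eq_pint (mul_pos hr.1 hs.1) (mul_lt_of_lt_one_left hs.1 hr.2) hs.2 t
  rw [mul_div_cancel_right₀ _ hs.1.ne'] at hpint
  exact (congrArg norm hpint).trans_le (norm_pint_le hr.1.le hr.2 (U s) t)

/-- The real and imaginary parts of `U` are differences of nonnegative Poisson families. -/
lemma ae_hasRadialLimit_of_hardyNorm_ne_top (hU : IsPoissonFamily U) (hfin : hardyNorm U ≠ ∞) :
    ∀ᵐ t ∂arc, HasRadialLimit fun r => U r t := by
  obtain ⟨V, hV, hle⟩ := exists_isPoissonFamily_norm_le hU hfin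
  have hpart (L : ℂ →L[ℝ] ℝ) (hL : ∀ z, |L z| ≤ ‖z‖) :
      ∀ᵐ t ∂arc, HasRadialLimit fun r => ((V r t + L (U r t) : ℝ) : ℂ) := by
    refine ae_hasRadialLimit_of_nonneg ?_ fun r hr t => ?_
    · simpa using hV.add (hU.clm_comp (Complex.ofRealCLM.comp L))
    · linarith [neg_abs_le (L (U r t)), hL (U r t), hle r hr t]
  filter_upwards [hpart 0 (by simp), hpart Complex.reCLM Complex.abs_re_le_norm,
    hpart Complex.imCLM Complex.abs_im_le_norm] with t ⟨v, hv⟩ ⟨x, hx⟩ ⟨y, hy⟩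
  refine ⟨x - v + (y - v) * Complex.I,
    ((hx.sub hv).add ((hy.sub hv).mul_const _)).congr fun r => ?_⟩
  simp

end Fatou

section Orbits

variable {a : (ℕ →₀ ℤ) → ℂ} {A : ℝ} {B : ℝ≥0∞}

lemma lintegral_lintegral_flow {Φ : Torus → ℝ≥0∞} (hΦ : Measurable Φ) :
    ∫⁻ θ, ∫⁻ t, Φ (flow t θ) ∂arc ∂haar = ∫⁻ θ, Φ θ ∂haar := by
  rw [lintegral_lintegral_swap (f := fun θ t => Φ (flow t θ))
    (hΦ.comp (continuous_flow.comp continuous_swap).measurable).aemeasurable]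
  simp only [(measurePreserving_flow _).lintegral_comp hΦ, lintegral_const, measure_univ, mul_one]

lemma continuous_flow_left (θ : Torus) : Continuous fun t => flow t θ :=
  continuous_flow.comp (continuous_id.prodMk continuous_const)

lemma lintegral_arc_flow_mem {E : Set Torus} (hE : MeasurableSet E) :
    ∫⁻ θ, arc {t | flow t θ ∈ E} ∂haar = haar E := by
  rw [← lintegral_indicator_one hE, ← lintegral_lintegral_flow (measurable_one.indicator hE)]
  exact lintegral_congr fun θ =>
    (lintegral_indicator_one ((continuous_flow_left θ).measurable hE)).symm

lemma ae_of_ae_flow {p : Torus → Prop} (hp : MeasurableSet {θ | p θ})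
    (h : ∀ᵐ θ ∂haar, ∀ᵐ t ∂arc, p (flow t θ)) : ∀ᵐ θ ∂haar, p θ := by
  rw [ae_iff]
  exact (lintegral_arc_flow_mem hp.compl).symm.trans
    ((lintegral_congr_ae (h.mono fun θ hθ => ae_iff.1 hθ)).trans lintegral_zero)

lemma twist_of_nonneg {ν : ℕ →₀ ℤ} (h : ∀ j, 0 ≤ ν j) : twist ν = weight ν := by
  rw [twist, weight, Finsupp.sum, Finsupp.sum]
  push_cast
  exact Finset.sum_congr rfl fun j _ => by rw [abs_of_nonneg (h j)]

lemma twist_neg (ν : ℕ →₀ ℤ) : twist (-ν) = -twist ν := by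
  rw [twist, Finsupp.sum_neg_index (fun _ => mul_zero _), twist, Finsupp.sum, Finsupp.sum]
  simp only [mul_neg, Finset.sum_neg_distrib]

lemma HarmonicSpectrum.natAbs_twist (hspec : HarmonicSpectrum a) {ν : ℕ →₀ ℤ} (hν : a ν ≠ 0) :
    (twist ν).natAbs = weight ν := by
  rcases hspec ν hν with h | h
  · rw [twist_of_nonneg h, Int.natAbs_natCast]
  · rw [← Int.natAbs_neg, ← twist_neg, twist_of_nonneg fun j => by simpa using h j, weight_neg,
      Int.natAbs_natCast]

lemma AnalyticSpectrum.harmonicSpectrum (h : AnalyticSpectrum a) : HarmonicSpectrum a :=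
  fun ν hν => .inl (h ν hν)

lemma isPoissonFamily_extension_flow (ha : ∀ ν, ‖a ν‖ ≤ A) (hspec : HarmonicSpectrum a)
    (θ : Torus) : IsPoissonFamily fun r t => extension a r (flow t θ) := by
  have hpow (ν : ℕ →₀ ℤ) (z : ℂ) : a ν * z ^ (twist ν).natAbs = a ν * z ^ weight ν := by
    by_cases hν : a ν = 0
    · simp [hν]
    · rw [hspec.natAbs_twist hν]
  refine isPoissonFamily_of_hasSum (b := fun ν => a ν * char ν θ) (k := twist) (fun r hr => ?_)
    fun r hr t => ?_
  · refine Summable.of_nonneg_of_le (fun _ => by have := hr.1; positivity) (fun ν => ?_)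
      ((summable_pow_weight hr.1.le hr.2).mul_left A)
    have hnorm := congrArg norm (hpow ν r)
    rw [norm_mul, norm_pow, Complex.norm_of_nonneg hr.1.le] at hnorm
    rw [norm_mul, norm_char, mul_one, hnorm]
    simpa using norm_extension_term ha hr.1.le ν 0
  · refine (hasSum_extension ha hr.1.le hr.2 (flow t θ)).congr_fun fun ν => ?_
    rw [char_flow, ← hpow]
    ring

lemma extension_flow_eq_of_analyticSpectrum (hspec : AnalyticSpectrum a) {r : ℝ} (hr : 0 ≤ r)
    (t : Circ) (θ : Torus) :
    extension a r (flow t θ) = ∑' ν, a ν * char ν θ * (r * fourier 1 t) ^ weight ν := by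
  rw [extension_ofReal hr]
  refine tsum_congr fun ν => ?_
  by_cases hν : a ν = 0
  · simp [hν]
  · rw [char_flow, twist_of_nonneg (hspec ν hν), fourier_natCast, mul_pow]
    ring

lemma differentiableOn_tsum_pow_weight (ha : ∀ ν, ‖a ν‖ ≤ A) :
    DifferentiableOn ℂ (fun z => ∑' ν, a ν * z ^ weight ν) (Metric.ball 0 1) := by
  have hA : 0 ≤ A := (norm_nonneg _).trans (ha 0)
  intro z hz
  obtain ⟨s, hzs, hs⟩ := exists_between (mem_ball_zero_iff.1 hz)
  have hdiff : DifferentiableOn ℂ (fun z => ∑' ν, a ν * z ^ weight ν) (Metric.ball 0 s) :=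
    Complex.differentiableOn_tsum_of_summable_norm
      ((summable_pow_weight ((norm_nonneg z).trans hzs.le) hs).mul_left A) (fun ν => by fun_prop)
      Metric.isOpen_ball fun ν w hw => by
        rw [norm_mul, norm_pow]
        gcongr
        exacts [ha ν, (mem_ball_zero_iff.1 hw).le]
  exact (hdiff.differentiableAt (Metric.isOpen_ball.mem_nhds
    (mem_ball_zero_iff.2 hzs))).differentiableWithinAt

lemma measurable_lintegral_enorm_flow {g : Torus → ℂ} (hg : Continuous g) :
    Measurable fun θ => ∫⁻ t, ‖g (flow t θ)‖ₑ ∂arc :=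
  Measurable.lintegral_prod_right' (f := fun p : Torus × Circ => ‖g (flow p.2 p.1)‖ₑ)
    (hg.comp (continuous_flow.comp continuous_swap)).enorm.measurable

lemma measurable_hardyNorm_flow (ha : ∀ ν, ‖a ν‖ ≤ A) (hspec : HarmonicSpectrum a) :
    Measurable fun θ => hardyNorm fun r t => extension a r (flow t θ) := by
  obtain ⟨s, -, hs, hlim⟩ := exists_seq_mem_Ioo_tendsto_one
  simp only [(isPoissonFamily_extension_flow ha hspec _).hardyNorm_eq_iSup hs hlim]
  exact .iSup fun n =>
    measurable_lintegral_enorm_flow (continuous_extension ha (hs n).1.le (hs n).2)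

lemma lintegral_hardyNorm_flow_le (ha : ∀ ν, ‖a ν‖ ≤ A) (hspec : HarmonicSpectrum a)
    (hB : ∀ s ∈ Set.Ioo (0 : ℝ) 1, normOne (extension a (s : ℂ)) ≤ B) :
    ∫⁻ θ, hardyNorm (fun r t => extension a r (flow t θ)) ∂haar ≤ B := by
  obtain ⟨s, hmono, hs, hlim⟩ := exists_seq_mem_Ioo_tendsto_one
  have hcont (n : ℕ) : Continuous (extension a (s n : ℂ)) :=
    continuous_extension ha (hs n).1.le (hs n).2
  have hfam := isPoissonFamily_extension_flow ha hspec
  simp only [(hfam _).hardyNorm_eq_iSup hs hlim]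
  rw [lintegral_iSup (fun n => measurable_lintegral_enorm_flow (hcont n)) fun m n hmn θ =>
    (hfam θ).monotoneOn_lintegral_enorm (hs m) (hs n) (hmono hmn)]
  refine iSup_le fun n => ?_
  rw [lintegral_lintegral_flow (hcont n).enorm.measurable]
  exact hB _ (hs n)

lemma measurable_radialSup_extension (ha : ∀ ν, ‖a ν‖ ≤ A) :
    Measurable fun θ => radialSup 1 fun r => extension a r θ :=
  measurable_radialSup fun _ hr => continuous_extension ha hr.1.le hr.2

theorem mul_haar_lt_radialSup_extension_le (ha : ∀ ν, ‖a ν‖ ≤ A) (hspec : HarmonicSpectrum a)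
    (hB : ∀ s ∈ Set.Ioo (0 : ℝ) 1, normOne (extension a (s : ℂ)) ≤ B) (c : ℝ≥0∞) :
    c * haar {θ | c < radialSup 1 fun r => extension a r θ} ≤ 80 * B := by
  rw [← lintegral_arc_flow_mem
    (measurableSet_lt measurable_const (measurable_radialSup_extension ha))]
  calc c * ∫⁻ θ, arc {t | c < radialSup 1 fun r => extension a r (flow t θ)} ∂haar
      ≤ ∫⁻ θ, c * arc {t | c < radialSup 1 fun r => extension a r (flow t θ)} ∂haar :=
        lintegral_const_mul_le _ _
    _ ≤ ∫⁻ θ, 80 * hardyNorm (fun r t => extension a r (flow t θ)) ∂haar :=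
        lintegral_mono fun θ =>
          mul_arc_lt_radialSup_le (isPoissonFamily_extension_flow ha hspec θ) c
    _ ≤ 80 * B := by
        rw [lintegral_const_mul' _ _ (by norm_num)]
        gcongr
        exact lintegral_hardyNorm_flow_le ha hspec hB

theorem lintegral_radialSup_extension_le (ha : ∀ ν, ‖a ν‖ ≤ A) (hspec : AnalyticSpectrum a)
    (hB : ∀ s ∈ Set.Ioo (0 : ℝ) 1, normOne (extension a (s : ℂ)) ≤ B) :
    ∫⁻ θ, radialSup 1 (fun r => extension a r θ) ∂haar ≤ 10240 * B := by
  have horbit (θ : Torus) : ∫⁻ t, radialSup 1 (fun r => extension a r (flow t θ)) ∂arc ≤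
      10240 * hardyNorm fun r t => extension a r (flow t θ) := by
    let F : ℂ → ℂ := fun z => ∑' ν, a ν * char ν θ * z ^ weight ν
    have hF {r : ℝ} (hr : r ∈ Set.Ioo (0 : ℝ) 1) (t : Circ) :
        extension a r (flow t θ) = F (r * fourier 1 t) :=
      extension_flow_eq_of_analyticSpectrum hspec hr.1.le t θ
    have hsup (t : Circ) : radialSup 1 (fun r => extension a r (flow t θ)) =
        radialSup 1 fun r => F (r * fourier 1 t) :=
      iSup_congr fun r => iSup_congr fun hr => by simp only [hF hr]
    have hnorm : hardyNorm (fun r t => extension a r (flow t θ)) =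
        hardyNorm fun r t => F (r * fourier 1 t) :=
      iSup_congr fun r => iSup_congr fun hr => by simp only [hF hr]
    simp only [hsup, hnorm]
    exact lintegral_radialSup_le (differentiableOn_tsum_pow_weight (A := A) fun ν => by
      simpa using ha ν)
  rw [← lintegral_lintegral_flow (measurable_radialSup_extension ha)]
  calc ∫⁻ θ, ∫⁻ t, radialSup 1 (fun r => extension a r (flow t θ)) ∂arc ∂haar
      ≤ ∫⁻ θ, 10240 * hardyNorm (fun r t => extension a r (flow t θ)) ∂haar :=
        lintegral_mono horbit
    _ ≤ 10240 * B := by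
        rw [lintegral_const_mul' _ _ (by norm_num)]
        gcongr
        exact lintegral_hardyNorm_flow_le ha hspec.harmonicSpectrum hB

lemma measurableSet_hasRadialLimit {X : Type*} [TopologicalSpace X] [MeasurableSpace X]
    [OpensMeasurableSpace X] {U : ℝ → X → ℂ} (hU : ∀ r ∈ Set.Ioo (0 : ℝ) 1, Continuous (U r)) :
    MeasurableSet {x | HasRadialLimit fun r => U r x} := by
  obtain ⟨S, hS, hbasis⟩ := ((𝓝[<] (1 : ℝ)).basis_sets.restrict_subset
    eventually_mem_Ioo_zero_one).exists_antitone_subbasis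
  have hcauchy (x : X) : (HasRadialLimit fun r => U r x) ↔ ∀ m : ℕ, ∃ n : ℕ,
      ∀ r ∈ S n, ∀ r' ∈ S n, dist (U r x) (U r' x) ≤ 1 / ((m : ℝ) + 1) := by
    rw [HasRadialLimit, ← cauchy_map_iff_exists_tendsto, cauchy_map_iff,
      and_iff_right (inferInstance : (𝓝[<] (1 : ℝ)).NeBot), (hbasis.1.prod_self).tendsto_iff
        (Metric.mk_uniformity_basis_le (p := fun _ : ℕ => True)
          (f := fun m : ℕ => 1 / ((m : ℝ) + 1)) (fun m _ => by positivity)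
          fun ε hε => (exists_nat_one_div_lt hε).imp fun m hm => ⟨trivial, hm.le⟩)]
    simp only [true_and, true_imp_iff, id, Prod.forall, Set.mem_prod, and_imp, Set.mem_ofPred_eq]
    simp only [forall_comm (α := ℝ) (β := _ ∈ _)]
  simp only [hcauchy, Set.ofPred_forall, Set.ofPred_exists]
  refine .iInter fun m => .iUnion fun n => IsClosed.measurableSet ?_
  exact isClosed_iInter fun r => isClosed_iInter fun hr => isClosed_iInter fun r' =>
    isClosed_iInter fun hr' => isClosed_le
      ((hU r ((hS n).2 hr)).dist (hU r' ((hS n).2 hr'))) continuous_const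

theorem ae_hasRadialLimit_extension (ha : ∀ ν, ‖a ν‖ ≤ A) (hspec : HarmonicSpectrum a)
    (hBtop : B ≠ ∞) (hB : ∀ s ∈ Set.Ioo (0 : ℝ) 1, normOne (extension a (s : ℂ)) ≤ B) :
    ∀ᵐ θ ∂haar, HasRadialLimit fun r => extension a r θ := by
  refine ae_of_ae_flow (measurableSet_hasRadialLimit fun r hr =>
    continuous_extension ha hr.1.le hr.2) ?_
  have hfin := ne_top_of_le_ne_top hBtop (lintegral_hardyNorm_flow_le ha hspec hB)
  filter_upwards [ae_lt_top (measurable_hardyNorm_flow ha hspec) hfin] with θ hθ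
  exact ae_hasRadialLimit_of_hardyNorm_ne_top (isPoissonFamily_extension_flow ha hspec θ) hθ.ne

end Orbits

section PoissonKernel

open scoped ComplexOrder

variable {r : ℝ}

/-- The Poisson kernel `∑_ν r^{|ν*|₁} e^{iν·θ}` of the infinite torus. -/
def kernel (r : ℝ) (θ : Torus) : ℂ := extension (fun _ => 1) r θ

lemma hasSum_kernel (h0 : 0 ≤ r) (h1 : r < 1) (θ : Torus) :
    HasSum (fun ν => (r : ℂ) ^ weight ν * char ν θ) (kernel r θ) := by
  simpa only [one_mul, kernel] using hasSum_extension (fun _ => norm_one.le) h0 h1 θ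

lemma continuous_kernel (h0 : 0 ≤ r) (h1 : r < 1) : Continuous (kernel r) :=
  continuous_extension (fun _ => norm_one.le) h0 h1

lemma hasProd_kernel (h0 : 0 ≤ r) (h1 : r < 1) (θ : Torus) :
    HasProd (fun j => (poisson (r ^ (j + 1)) (θ j) : ℂ)) (kernel r θ) := by
  have hterm (ν : ℕ →₀ ℤ) : (r : ℂ) ^ weight ν * char ν θ =
      ν.prod fun j n => ((r ^ (j + 1) : ℝ) : ℂ) ^ n.natAbs * fourier n (θ j) := by
    rw [pow_weight_eq_prod, char, ← Finsupp.prod_mul]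
    simp only [Complex.ofReal_pow]
  have hsum := hasSum_kernel h0 h1 θ
  simp only [hterm] at hsum
  exact hasProd_of_hasSum_finsupp_prod (fun j => by simp)
    (fun j => hasSum_poisson (by positivity) (pow_lt_one₀ h0 h1 j.succ_ne_zero) (θ j)) hsum

lemma kernel_nonneg (h0 : 0 ≤ r) (h1 : r < 1) (θ : Torus) : 0 ≤ kernel r θ :=
  ge_of_tendsto' (hasProd_kernel h0 h1 θ) fun _ => Finset.prod_nonneg fun j _ =>
    Complex.zero_le_real.2 (poisson_nonneg (by positivity) (pow_lt_one₀ h0 h1 j.succ_ne_zero) _)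

lemma lintegral_enorm_kernel (h0 : 0 ≤ r) (h1 : r < 1) : ∫⁻ θ, ‖kernel r θ‖ₑ ∂haar = 1 := by
  have hmean : ∫ θ, kernel r θ ∂haar = 1 := by
    simpa [kernel] using integral_extension_mul_char (fun _ => norm_one.le) h0 h1 0
  have hnorm (θ : Torus) : (‖kernel r θ‖ : ℂ) = kernel r θ :=
    Complex.norm_of_nonneg' (kernel_nonneg h0 h1 θ)
  have hmean_norm : ∫ θ, ‖kernel r θ‖ ∂haar = 1 := by
    rw [← Complex.ofReal_inj, ← integral_complex_ofReal]
    simp only [hnorm, hmean, Complex.ofReal_one]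
  rw [← ofReal_integral_norm_eq_lintegral_enorm
    (integrable_of_continuous (continuous_kernel h0 h1)), hmean_norm, ENNReal.ofReal_one]

end PoissonKernel

section ComplexMeasures

instance isFiniteMeasure_variation {X : Type*} [MeasurableSpace X] (μ : ComplexMeasure X) :
    IsFiniteMeasure μ.variation := by
  refine isFiniteMeasure_of_le
    ((ComplexMeasure.re μ).totalVariation + (ComplexMeasure.im μ).totalVariation)
    (VectorMeasure.variation_le_of_forall_enorm_le fun E _ => ?_)
  calc ‖μ E‖ₑ = ‖((μ E).re : ℂ) + (μ E).im * Complex.I‖ₑ := by rw [Complex.re_add_im]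
    _ ≤ ‖(μ E).re‖ₑ + ‖(μ E).im‖ₑ := (enorm_add_le _ _).trans_eq (by simp [← ofReal_norm])
    _ ≤ _ := add_le_add ((ComplexMeasure.re μ).enorm_le_totalVariation E)
      ((ComplexMeasure.im μ).enorm_le_totalVariation E)

variable {μ : ComplexMeasure Torus}

lemma enorm_cintegral_le (μ : ComplexMeasure Torus) (g : Torus → ℂ) :
    ‖cintegral μ g‖ₑ ≤ ∫⁻ θ, ‖g θ‖ₑ ∂μ.variation := by
  refine VectorMeasure.enorm_integral_le_lintegral_enorm.trans_eq ?_
  rw [← ofReal_norm, ContinuousLinearMap.opNorm_mul, ENNReal.ofReal_one, one_mul]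

lemma cintegral_add {g h : Torus → ℂ} (hg : Continuous g) (hh : Continuous h) :
    cintegral μ (fun θ => g θ + h θ) = cintegral μ g + cintegral μ h :=
  VectorMeasure.integral_fun_add (integrable_of_continuous hg) (integrable_of_continuous hh)

lemma cintegral_const_mul (μ : ComplexMeasure Torus) (c : ℂ) (g : Torus → ℂ) :
    cintegral μ (fun θ => c * g θ) = c * cintegral μ g :=
  setToFun_smul _ (fun c s x => mul_assoc c x (μ s)) c g

lemma enorm_cintegral_le_of_norm_le {g : Torus → ℂ} {c : ℝ≥0} (hg : ∀ θ, ‖g θ‖ ≤ c) :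
    ‖cintegral μ g‖ₑ ≤ c * tvNorm μ :=
  calc ‖cintegral μ g‖ₑ ≤ ∫⁻ θ, ‖g θ‖ₑ ∂μ.variation := enorm_cintegral_le μ g
    _ ≤ ∫⁻ _, c ∂μ.variation := lintegral_mono fun θ => ENNReal.coe_le_coe.2 (hg θ)
    _ = c * tvNorm μ := lintegral_const _

lemma tvNorm_ne_top (μ : ComplexMeasure Torus) : tvNorm μ ≠ ∞ := measure_ne_top _ _

lemma norm_measureCoeff_le (μ : ComplexMeasure Torus) (ν : ℕ →₀ ℤ) :
    ‖measureCoeff μ ν‖ ≤ (tvNorm μ).toReal := by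
  have h := enorm_cintegral_le_of_norm_le (μ := μ) (c := 1) fun θ => (norm_char (-ν) θ).le
  rw [ENNReal.coe_one, one_mul] at h
  simpa [measureCoeff] using ENNReal.toReal_mono (tvNorm_ne_top μ) h

lemma measureExt_eq_cintegral_kernel {r : ℝ} (μ : ComplexMeasure Torus) (h0 : 0 ≤ r) (h1 : r < 1)
    (θ : Torus) : measureExt μ r θ = cintegral μ fun φ => kernel r (θ - φ) := by
  refine (hasSum_extension (norm_measureCoeff_le μ) h0 h1 θ).unique ?_
  have hsum : HasSum (fun ν => cintegral μ fun φ => (r : ℂ) ^ weight ν * char ν θ * char (-ν) φ)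
      (cintegral μ fun φ => kernel r (θ - φ)) :=
    VectorMeasure.hasSum_integral_of_dominated_convergence (fun ν _ => r ^ weight ν)
      (fun ν => Continuous.aestronglyMeasurable (by fun_prop))
      (fun ν => .of_forall fun φ => by simp [abs_of_nonneg h0])
      (.of_forall fun _ => summable_pow_weight h0 h1) (integrable_const _)
      (.of_forall fun φ => by
        simpa only [sub_eq_add_neg, char_add_arg, char_neg_arg, mul_assoc]
          using hasSum_kernel h0 h1 (θ - φ))
  convert! hsum using 2 with ν
  rw [cintegral_const_mul, mul_assoc, mul_comm]
  rfl

theorem normOne_measureExt_le (μ : ComplexMeasure Torus) {ξ : ℂ} (hξ : ‖ξ‖ < 1) :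
    normOne (measureExt μ ξ) ≤ tvNorm μ := by
  have hK := continuous_kernel (norm_nonneg ξ) hξ
  have hK_sub : Continuous (Function.uncurry fun θ φ : Torus => ‖kernel ‖ξ‖ (θ - φ)‖ₑ) :=
    (hK.comp (continuous_fst.sub continuous_snd)).enorm
  calc normOne (measureExt μ ξ)
      = ∫⁻ θ, ‖measureExt μ (‖ξ‖ : ℂ) (flow (ξ.arg : Circ) θ)‖ₑ ∂haar :=
        lintegral_congr fun θ => congrArg _ (extension_eq_flow (measureCoeff μ) ξ θ)
    _ = ∫⁻ θ, ‖measureExt μ (‖ξ‖ : ℂ) θ‖ₑ ∂haar :=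
        (measurePreserving_flow _).lintegral_comp (f := fun θ => ‖measureExt μ (‖ξ‖ : ℂ) θ‖ₑ)
          (continuous_extension (norm_measureCoeff_le μ) (norm_nonneg ξ) hξ).enorm.measurable
    _ ≤ ∫⁻ θ, ∫⁻ φ, ‖kernel ‖ξ‖ (θ - φ)‖ₑ ∂μ.variation ∂haar := lintegral_mono fun θ => by
        rw [measureExt_eq_cintegral_kernel μ (norm_nonneg ξ) hξ]
        exact enorm_cintegral_le μ _
    _ = ∫⁻ φ, ∫⁻ θ, ‖kernel ‖ξ‖ (θ - φ)‖ₑ ∂haar ∂μ.variation :=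
        lintegral_lintegral_swap hK_sub.measurable.aemeasurable
    _ = ∫⁻ _, 1 ∂μ.variation := lintegral_congr fun φ => by
        rw [lintegral_sub_right_eq_self (fun θ => ‖kernel ‖ξ‖ θ‖ₑ),
          lintegral_enorm_kernel (norm_nonneg ξ) hξ]
    _ = tvNorm μ := lintegral_one

end ComplexMeasures

section Densities

variable {X : Type*} [MeasurableSpace X] {ρ : Measure X} {f g : X → ℂ}

lemma integral_withDensityᵥ_simpleFunc (hf : Integrable f ρ) (g : SimpleFunc X ℂ) :
    (ρ.withDensityᵥ f).integral g (ContinuousLinearMap.mul ℝ ℂ) = ∫ x, g x * f x ∂ρ := by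
  induction g using SimpleFunc.induction with
  | @const c s hs =>
    have hind : ⇑(SimpleFunc.piecewise s hs (SimpleFunc.const X c) (SimpleFunc.const X 0)) =
        s.indicator fun _ => c := by classical exact Set.piecewise_eq_indicator
    simp only [hind, ← Set.indicator_mul_left]
    rw [integral_indicator hs, integral_const_mul, ← withDensityᵥ_apply hf hs]
    exact setToFun_indicator_const _ hs (measure_ne_top _ _) c
  | @add g h _ ihg ihh =>
    have hint (k : SimpleFunc X ℂ) : Integrable (fun x => k x * f x) ρ := by
      obtain ⟨C, hC⟩ := k.exists_forall_norm_le
      exact hf.bdd_mul k.aestronglyMeasurable (.of_forall hC)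
    simp only [SimpleFunc.coe_add, Pi.add_apply, add_mul]
    rw [integral_add (hint g) (hint h), ← ihg, ← ihh]
    exact VectorMeasure.integral_add (SimpleFunc.integrable_of_isFiniteMeasure g)
      (SimpleFunc.integrable_of_isFiniteMeasure h)

lemma integral_withDensityᵥ (hf : Integrable f ρ) (hg : StronglyMeasurable g) {C : ℝ≥0}
    (hC : ∀ x, ‖g x‖ ≤ C) :
    (ρ.withDensityᵥ f).integral g (ContinuousLinearMap.mul ℝ ℂ) = ∫ x, g x * f x ∂ρ := by
  have hlim (x : X) : Tendsto (fun n => hg.approxBounded C n x) atTop (𝓝 (g x)) :=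
    hg.tendsto_approxBounded_of_norm_le (hC x)
  have hle (n : ℕ) (x : X) := hg.norm_approxBounded_le C.2 n x
  refine tendsto_nhds_unique (VectorMeasure.tendsto_integral_of_dominated_convergence
    (fun _ => (C : ℝ))
    (fun n => (hg.approxBounded C n).aestronglyMeasurable) (integrable_const _)
    (fun n => .of_forall (hle n)) (.of_forall hlim)) ?_
  simp only [integral_withDensityᵥ_simpleFunc hf]
  refine tendsto_integral_of_dominated_convergence (fun x => C * ‖f x‖)
    (fun n => (hg.approxBounded C n).aestronglyMeasurable.mul hf.1) (hf.norm.const_mul C)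
    (fun n => .of_forall fun x => ?_) (.of_forall fun x => (hlim x).mul_const _)
  rw [norm_mul]
  exact mul_le_mul_of_nonneg_right (hle n x) (norm_nonneg _)

lemma tvNorm_withDensityᵥ {f : Torus → ℂ} (hf : Integrable f haar) :
    tvNorm (haar.withDensityᵥ f) = normOne f := by
  rw [tvNorm, Measure.variation_withDensityᵥ hf, withDensity_apply _ .univ, Measure.restrict_univ,
    normOne]

lemma measureCoeff_withDensityᵥ {f : Torus → ℂ} (hf : Integrable f haar) :
    measureCoeff (haar.withDensityᵥ f) = funCoeff f := by
  ext ν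
  rw [measureCoeff, cintegral, integral_withDensityᵥ (C := 1) hf
    (continuous_char (-ν)).stronglyMeasurable fun θ => (norm_char _ θ).le]
  simp only [funCoeff, mul_comm]

end Densities

section Density

/-- The star algebra of trigonometric polynomials on the infinite torus. -/
def charSubalgebra : StarSubalgebra ℂ C(Torus, ℂ) where
  toSubalgebra := Algebra.adjoin ℂ (Set.range charC)
  star_mem' := by
    change Algebra.adjoin ℂ (Set.range charC) ≤ star (Algebra.adjoin ℂ (Set.range charC))
    refine Algebra.adjoin_le ?_
    rintro _ ⟨ν, rfl⟩
    refine Algebra.subset_adjoin ⟨-ν, ?_⟩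
    ext θ
    simp [char_neg]

lemma charSubalgebra_coe :
    charSubalgebra.toSubalgebra.toSubmodule = Submodule.span ℂ (Set.range charC) := by
  refine Algebra.adjoin_eq_span_of_subset _ (subset_trans (fun x =>
    Submonoid.closure_induction (fun _ h => h) ⟨0, ?_⟩ ?_) Submodule.subset_span)
  · ext θ
    simp
  · rintro _ _ _ _ ⟨m, rfl⟩ ⟨n, rfl⟩
    refine ⟨m + n, ?_⟩
    ext θ
    simp [char_add]

lemma charSubalgebra_separatesPoints : charSubalgebra.SeparatesPoints := by
  intro x y hxy
  obtain ⟨j, hj⟩ := Function.ne_iff.1 hxy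
  refine ⟨_, ⟨charC (Finsupp.single j 1), Algebra.subset_adjoin ⟨_, rfl⟩, rfl⟩, ?_⟩
  simp only [charC_apply, char, Finsupp.prod_single_index, fourier_zero, fourier_one]
  contrapose hj
  exact AddCircle.injective_toCircle Real.two_pi_pos.ne' (Subtype.coe_injective hj)

theorem span_charC_closure_eq_top :
    (Submodule.span ℂ (Set.range charC)).topologicalClosure = ⊤ := by
  rw [← charSubalgebra_coe]
  exact congrArg (Subalgebra.toSubmodule <| StarSubalgebra.toSubalgebra ·)
    (ContinuousMap.starSubalgebra_topologicalClosure_eq_top_of_separatesPoints charSubalgebra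
      charSubalgebra_separatesPoints)

variable {ι 𝕜 E : Type*} [NormedField 𝕜] [SeminormedAddCommGroup E] [NormedSpace 𝕜 E]
  {S : Set E} {l : Filter ι} {D : ι → E → ℝ≥0∞} {C : ℝ≥0∞}

lemma tendsto_zero_of_mem_span (hadd : ∀ᶠ i in l, ∀ x y, D i (x + y) ≤ D i x + D i y)
    (hsmul : ∀ᶠ i in l, ∀ (c : 𝕜) x, D i (c • x) ≤ ‖c‖ₑ * D i x)
    (hS : ∀ x ∈ S, Tendsto (D · x) l (𝓝 0)) {x : E} (hx : x ∈ Submodule.span 𝕜 S) :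
    Tendsto (D · x) l (𝓝 0) := by
  have hsmul_lim {x : E} (c : 𝕜) (hx : Tendsto (D · x) l (𝓝 0)) :
      Tendsto (D · (c • x)) l (𝓝 0) := by
    have hlim := ENNReal.Tendsto.const_mul (a := ‖c‖ₑ) hx (.inr enorm_ne_top)
    rw [mul_zero] at hlim
    exact tendsto_of_tendsto_of_tendsto_of_le_of_le' tendsto_const_nhds hlim
      (.of_forall fun _ => zero_le) (hsmul.mono fun i hi => hi c x)
  induction hx using Submodule.span_induction with
  | mem x hx => exact hS x hx
  | zero =>
    refine tendsto_const_nhds.congr' (hsmul.mono fun i hi => ?_)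
    have hzero := hi 0 0
    rw [smul_zero, enorm_zero, zero_mul] at hzero
    exact (nonpos_iff_eq_zero.1 hzero).symm
  | add x y _ _ hx hy =>
    have hlim := hx.add hy
    rw [add_zero] at hlim
    exact tendsto_of_tendsto_of_tendsto_of_le_of_le' tendsto_const_nhds hlim
      (.of_forall fun _ => zero_le) (hadd.mono fun i hi => hi x y)
  | smul c x _ hx => exact hsmul_lim c hx

lemma tendsto_zero_of_span_dense (hdense : (Submodule.span 𝕜 S).topologicalClosure = ⊤)
    (hC : C ≠ ∞) (hadd : ∀ᶠ i in l, ∀ x y, D i (x + y) ≤ D i x + D i y)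
    (hsmul : ∀ᶠ i in l, ∀ (c : 𝕜) x, D i (c • x) ≤ ‖c‖ₑ * D i x)
    (hbound : ∀ᶠ i in l, ∀ x, D i x ≤ C * ‖x‖ₑ)
    (hS : ∀ x ∈ S, Tendsto (D · x) l (𝓝 0)) (x : E) : Tendsto (D · x) l (𝓝 0) := by
  refine ENNReal.tendsto_nhds_zero.2 fun ε hε => ?_
  have hcont : Tendsto (fun y : E => C * ‖x - y‖ₑ) (𝓝 x) (𝓝 0) := by
    have hedist : Tendsto (edist x) (𝓝 x) (𝓝 0) :=
      edist_self x ▸ (continuous_const.edist continuous_id).tendsto x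
    simpa only [edist_eq_enorm_sub, mul_zero] using ENNReal.Tendsto.const_mul hedist (.inr hC)
  have hx : x ∈ closure (Submodule.span 𝕜 S : Set E) := by
    rw [← Submodule.topologicalClosure_coe, hdense]
    trivial
  obtain ⟨y, hyx, hy⟩ := mem_closure_iff_nhds.1 hx _
    (ENNReal.tendsto_nhds_zero.1 hcont (ε / 2) (ENNReal.half_pos hε.ne'))
  filter_upwards [hadd, hbound, ENNReal.tendsto_nhds_zero.1
    (tendsto_zero_of_mem_span hadd hsmul hS hy) (ε / 2) (ENNReal.half_pos hε.ne')]
    with i hadd_i hbound_i hy_i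
  calc D i x = D i ((x - y) + y) := by rw [sub_add_cancel]
    _ ≤ D i (x - y) + D i y := hadd_i _ _
    _ ≤ ε / 2 + ε / 2 := add_le_add ((hbound_i _).trans hyx) hy_i
    _ = ε := ENNReal.add_halves ε

end Density

section Measures

lemma norm_ofReal_lt_one {r : ℝ} (hr : r ∈ Set.Ioo (0 : ℝ) 1) : ‖(r : ℂ)‖ < 1 := by
  rw [Complex.norm_of_nonneg hr.1.le]
  exact hr.2

lemma tendsto_ofReal_pow_nhdsLT_one (n : ℕ) :
    Tendsto (fun r : ℝ => (r : ℂ) ^ n) (𝓝[<] 1) (𝓝 1) := by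
  have hcont : Continuous fun r : ℝ => (r : ℂ) ^ n := by fun_prop
  simpa using (hcont.tendsto 1).mono_left nhdsWithin_le_nhds

variable {μ : ComplexMeasure Torus}

lemma continuous_measureExt {r : ℝ} (hr : r ∈ Set.Ioo (0 : ℝ) 1) : Continuous (measureExt μ r) :=
  continuous_extension (norm_measureCoeff_le μ) hr.1.le hr.2

lemma enorm_integral_mul_measureExt_le {r : ℝ} (hr : r ∈ Set.Ioo (0 : ℝ) 1) (g : C(Torus, ℂ)) :
    ‖∫ θ, g θ * measureExt μ r θ ∂haar‖ₑ ≤ tvNorm μ * ‖g‖ₑ :=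
  calc ‖∫ θ, g θ * measureExt μ r θ ∂haar‖ₑ
      ≤ ∫⁻ θ, ‖g θ * measureExt μ r θ‖ₑ ∂haar := enorm_integral_le_lintegral_enorm _
    _ ≤ ∫⁻ θ, ‖g‖ₑ * ‖measureExt μ r θ‖ₑ ∂haar := lintegral_mono fun θ => by
        rw [enorm_mul]
        gcongr
        exact enorm_le_iff_norm_le.2 (g.norm_coe_le_norm θ)
    _ = ‖g‖ₑ * normOne (measureExt μ r) := lintegral_const_mul' _ _ enorm_ne_top
    _ ≤ tvNorm μ * ‖g‖ₑ := by
        rw [mul_comm]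
        gcongr
        exact normOne_measureExt_le μ (norm_ofReal_lt_one hr)

theorem tendsto_integral_mul_measureExt (μ : ComplexMeasure Torus) (g : C(Torus, ℂ)) :
    Tendsto (fun r : ℝ => ∫ θ, g θ * measureExt μ r θ ∂haar) (𝓝[<] 1) (𝓝 (cintegral μ g)) := by
  have hint {r : ℝ} (hr : r ∈ Set.Ioo (0 : ℝ) 1) (g : C(Torus, ℂ)) :
      Integrable (fun θ => g θ * measureExt μ r θ) haar :=
    integrable_of_continuous (g.continuous.mul (continuous_measureExt hr))
  rw [tendsto_iff_edist_tendsto_0]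
  simp only [edist_eq_enorm_sub]
  refine tendsto_zero_of_span_dense (𝕜 := ℂ) (C := 2 * tvNorm μ)
    (D := fun (r : ℝ) (g : C(Torus, ℂ)) =>
      ‖∫ θ, g θ * measureExt μ r θ ∂haar - cintegral μ g‖ₑ)
    span_charC_closure_eq_top (ENNReal.mul_ne_top ENNReal.ofNat_ne_top (tvNorm_ne_top μ))
    (eventually_mem_Ioo_zero_one.mono fun r hr g h => ?_)
    (.of_forall fun r c g => ?_) (eventually_mem_Ioo_zero_one.mono fun r hr g => ?_) ?_ g
  · have hadd := cintegral_add (μ := μ) g.continuous h.continuous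
    simp only [ContinuousMap.coe_add, Pi.add_def, add_mul, integral_add (hint hr g) (hint hr h),
      hadd, add_sub_add_comm]
    exact enorm_add_le _ _
  · have hsmul := cintegral_const_mul μ c g
    simp only [ContinuousMap.coe_smul, Pi.smul_def, smul_eq_mul, mul_assoc, integral_const_mul,
      hsmul, ← mul_sub, enorm_mul, le_refl]
  · refine (enorm_sub_le.trans (add_le_add (enorm_integral_mul_measureExt_le hr g)
      (enorm_cintegral_le_of_norm_le (c := ‖g‖₊) g.norm_coe_le_norm))).trans_eq ?_
    rw [← enorm_eq_nnnorm]
    ring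
  · rintro _ ⟨ν, rfl⟩
    have hlim := (tendsto_ofReal_pow_nhdsLT_one (weight ν)).const_mul (measureCoeff μ (-ν))
    rw [mul_one, tendsto_iff_edist_tendsto_0] at hlim
    refine hlim.congr' (eventually_mem_Ioo_zero_one.mono fun r hr => ?_)
    have hcoeff : cintegral μ (charC ν) = measureCoeff μ (-ν) := by
      rw [measureCoeff, neg_neg]
      rfl
    rw [edist_eq_enorm_sub, hcoeff,
      ← integral_extension_mul_char (norm_measureCoeff_le μ) hr.1.le hr.2]
    simp only [charC_apply, mul_comm (char ν _), measureExt]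

theorem haar_lt_measureMax_le (hμ : HarmonicSpectrum (measureCoeff μ)) {t : ℝ} (ht : 0 < t) :
    haar {θ | ENNReal.ofReal t < measureMax μ θ} ≤ 80 * tvNorm μ / ENNReal.ofReal t := by
  rw [ENNReal.le_div_iff_mul_le (.inl (ENNReal.ofReal_pos.2 ht).ne') (.inl ENNReal.ofReal_ne_top),
    mul_comm]
  exact mul_haar_lt_radialSup_extension_le (norm_measureCoeff_le μ) hμ
    (fun _ hs => normOne_measureExt_le μ (norm_ofReal_lt_one hs)) _

theorem lintegral_measureMax_le (hμ : AnalyticSpectrum (measureCoeff μ)) :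
    ∫⁻ θ, measureMax μ θ ∂haar ≤ 10240 * tvNorm μ :=
  lintegral_radialSup_extension_le (norm_measureCoeff_le μ) hμ
    fun _ hs => normOne_measureExt_le μ (norm_ofReal_lt_one hs)

theorem ae_hasRadialLimit_measureExt (hμ : HarmonicSpectrum (measureCoeff μ)) :
    ∀ᵐ θ ∂haar, HasRadialLimit fun r => measureExt μ r θ :=
  ae_hasRadialLimit_extension (norm_measureCoeff_le μ) hμ (tvNorm_ne_top μ)
    fun _ hs => normOne_measureExt_le μ (norm_ofReal_lt_one hs)

end Measures

section Functions

variable {f g : Torus → ℂ} {r : ℝ}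

lemma measureExt_withDensityᵥ (hf : Integrable f haar) :
    measureExt (haar.withDensityᵥ f) = funExt f := by
  ext ξ θ
  rw [measureExt, funExt, measureCoeff_withDensityᵥ hf]

lemma normOne_funExt_le (hf : Integrable f haar) (hr : r ∈ Set.Ioo (0 : ℝ) 1) :
    normOne (funExt f r) ≤ normOne f := by
  rw [← measureExt_withDensityᵥ hf, ← tvNorm_withDensityᵥ hf]
  exact normOne_measureExt_le _ (norm_ofReal_lt_one hr)

lemma continuous_funExt (hf : Integrable f haar) (hr : r ∈ Set.Ioo (0 : ℝ) 1) :
    Continuous (funExt f r) := by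
  rw [← measureExt_withDensityᵥ hf]
  exact continuous_measureExt hr

theorem lintegral_funMax_le (hf : MemHardyOne f) : ∫⁻ θ, funMax f θ ∂haar ≤ 10240 * normOne f := by
  have hspec : AnalyticSpectrum (measureCoeff (haar.withDensityᵥ f)) := by
    rw [measureCoeff_withDensityᵥ hf.1]
    exact hf.2
  simpa only [measureMax, funMax, measureExt_withDensityᵥ hf.1, tvNorm_withDensityᵥ hf.1]
    using lintegral_measureMax_le hspec

lemma funExt_add (hf : Integrable f haar) (hg : Integrable g haar) (hr : r ∈ Set.Ioo (0 : ℝ) 1)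
    (θ : Torus) : funExt (f + g) r θ = funExt f r θ + funExt g r θ := by
  have hmul {h : Torus → ℂ} (hh : Integrable h haar) (ν : ℕ →₀ ℤ) :
      Integrable (fun θ => h θ * char ν θ) haar :=
    hh.mul_bdd (continuous_char ν).aestronglyMeasurable (.of_forall fun θ => (norm_char ν θ).le)
  have hcoeff (ν : ℕ →₀ ℤ) : funCoeff (f + g) ν = funCoeff f ν + funCoeff g ν := by
    simp only [funCoeff, Pi.add_apply, add_mul]
    exact integral_add (hmul hf _) (hmul hg _)
  have hsum {h : Torus → ℂ} (hh : Integrable h haar) :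
      HasSum (fun ν => funCoeff h ν * (r : ℂ) ^ weight ν * char ν θ) (funExt h r θ) := by
    simp only [funExt, ← measureCoeff_withDensityᵥ hh]
    exact hasSum_extension (norm_measureCoeff_le _) hr.1.le hr.2 θ
  refine (hsum (hf.add hg)).unique ?_
  simpa only [hcoeff, add_mul] using (hsum hf).add (hsum hg)

lemma funExt_const_smul (c : ℂ) (f : Torus → ℂ) (hr : 0 ≤ r) (θ : Torus) :
    funExt (c • f) r θ = c * funExt f r θ := by
  have hcoeff (ν : ℕ →₀ ℤ) : funCoeff (c • f) ν = c * funCoeff f ν := by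
    simp only [funCoeff, Pi.smul_apply, smul_eq_mul, mul_assoc, integral_const_mul]
  simp only [funExt, extension_ofReal hr, hcoeff, mul_assoc, tsum_mul_left]

lemma funExt_char (ν : ℕ →₀ ℤ) (hr : 0 ≤ r) (θ : Torus) :
    funExt (char ν) r θ = (r : ℂ) ^ weight ν * char ν θ := by
  have hcoeff (κ : ℕ →₀ ℤ) : funCoeff (char ν) κ = if κ = ν then 1 else 0 := by
    simp only [funCoeff, ← char_add, integral_char, ← sub_eq_add_neg, sub_eq_zero, eq_comm]
  simp [funExt, extension_ofReal hr, hcoeff]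

lemma normOne_add_le (hf : AEStronglyMeasurable f haar) :
    normOne (f + g) ≤ normOne f + normOne g := by
  rw [normOne, normOne, normOne, ← lintegral_add_left' hf.enorm]
  exact lintegral_mono fun θ => enorm_add_le _ _

lemma normOne_const_smul (c : ℂ) (f : Torus → ℂ) : normOne (c • f) = ‖c‖ₑ * normOne f := by
  simp only [normOne, Pi.smul_apply, enorm_smul]
  exact lintegral_const_mul' _ _ enorm_ne_top

lemma normOne_le_enorm (g : C(Torus, ℂ)) : normOne g ≤ ‖g‖ₑ :=
  calc normOne g ≤ ∫⁻ _, ‖g‖ₑ ∂haar :=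
        lintegral_mono fun θ => enorm_le_iff_norm_le.2 (g.norm_coe_le_norm θ)
    _ = ‖g‖ₑ := by simp

/-- The distance `‖f_r - f‖₁`, as a function of `r` and `f`. -/
def radialError (r : ℝ) (f : Torus → ℂ) : ℝ≥0∞ := normOne fun θ => funExt f r θ - f θ

lemma radialError_add_le (hf : Integrable f haar) (hg : Integrable g haar)
    (hr : r ∈ Set.Ioo (0 : ℝ) 1) :
    radialError r (f + g) ≤ radialError r f + radialError r g := by
  simp only [radialError, funExt_add hf hg hr, Pi.add_apply, add_sub_add_comm]
  exact normOne_add_le ((continuous_funExt hf hr).aestronglyMeasurable.sub hf.1)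

lemma radialError_const_smul (c : ℂ) (f : Torus → ℂ) (hr : 0 ≤ r) :
    radialError r (c • f) = ‖c‖ₑ * radialError r f := by
  simp only [radialError, funExt_const_smul c f hr, Pi.smul_apply, smul_eq_mul, ← mul_sub]
  exact normOne_const_smul c _

lemma radialError_le (hf : Integrable f haar) (hr : r ∈ Set.Ioo (0 : ℝ) 1) :
    radialError r f ≤ 2 * normOne f :=
  calc radialError r f ≤ ∫⁻ θ, (‖funExt f r θ‖ₑ + ‖f θ‖ₑ) ∂haar :=
        lintegral_mono fun θ => enorm_sub_le
    _ = normOne (funExt f r) + normOne f :=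
        lintegral_add_left (continuous_funExt hf hr).enorm.measurable _
    _ ≤ 2 * normOne f := by
        rw [two_mul]
        gcongr
        exact normOne_funExt_le hf hr

lemma tendsto_radialError_char (ν : ℕ →₀ ℤ) :
    Tendsto (fun r => radialError r (char ν)) (𝓝[<] 1) (𝓝 0) := by
  have hlim := (tendsto_ofReal_pow_nhdsLT_one (weight ν)).sub_const 1
  rw [sub_self] at hlim
  refine (enorm_zero (E := ℂ) ▸ hlim.enorm).congr' (eventually_mem_Ioo_zero_one.mono fun r hr => ?_)
  have hchar (θ : Torus) : ‖char ν θ‖ₑ = 1 := by simp [← ofReal_norm]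
  simp [radialError, normOne, funExt_char ν hr.1.le, ← sub_one_mul, enorm_mul, hchar]

lemma tendsto_radialError_continuous (g : C(Torus, ℂ)) :
    Tendsto (fun r => radialError r g) (𝓝[<] 1) (𝓝 0) := by
  have hint (g : C(Torus, ℂ)) : Integrable g haar := integrable_of_continuous g.continuous
  refine tendsto_zero_of_span_dense (𝕜 := ℂ) (C := 2)
    (D := fun (r : ℝ) (g : C(Torus, ℂ)) => radialError r g)
    span_charC_closure_eq_top ENNReal.ofNat_ne_top
    (eventually_mem_Ioo_zero_one.mono fun r hr g h => radialError_add_le (hint g) (hint h) hr)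
    (eventually_mem_Ioo_zero_one.mono fun r hr c g => (radialError_const_smul c g hr.1.le).le)
    (eventually_mem_Ioo_zero_one.mono fun r hr g => (radialError_le (hint g) hr).trans ?_) ?_ g
  · gcongr
    exact normOne_le_enorm g
  · rintro _ ⟨ν, rfl⟩
    exact tendsto_radialError_char ν

theorem tendsto_radialError (hf : Integrable f haar) :
    Tendsto (fun r => radialError r f) (𝓝[<] 1) (𝓝 0) := by
  refine ENNReal.tendsto_nhds_zero.2 fun ε hε => ?_
  have hε2 := ENNReal.half_pos hε.ne'
  obtain ⟨g, hfg, hg⟩ := hf.exists_boundedContinuous_lintegral_sub_le (ENNReal.half_pos hε2.ne').ne'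
  filter_upwards [ENNReal.tendsto_nhds_zero.1 (tendsto_radialError_continuous g.toContinuousMap)
    (ε / 2) hε2, eventually_mem_Ioo_zero_one] with r hgr hr
  calc radialError r f = radialError r ((f - g) + g) := by rw [sub_add_cancel]
    _ ≤ radialError r (f - g) + radialError r g := radialError_add_le (hf.sub hg) hg hr
    _ ≤ 2 * (ε / 2 / 2) + ε / 2 :=
        add_le_add ((radialError_le (hf.sub hg) hr).trans (mul_le_mul_right hfg 2)) hgr
    _ = ε := by rw [ENNReal.mul_div_cancel two_ne_zero ENNReal.ofNat_ne_top, ENNReal.add_halves]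

theorem ae_tendsto_funExt (hf : Integrable f haar) (hspec : HarmonicSpectrum (funCoeff f)) :
    ∀ᵐ θ ∂haar, Tendsto (fun r : ℝ => funExt f r θ) (𝓝[<] 1) (𝓝 (f θ)) := by
  rw [← measureCoeff_withDensityᵥ hf] at hspec
  have hlimit := ae_hasRadialLimit_measureExt hspec
  simp only [measureExt_withDensityᵥ hf] at hlimit
  obtain ⟨s, -, hs, hs1⟩ := exists_seq_mem_Ioo_tendsto_one
  have hs_left : Tendsto s atTop (𝓝[<] 1) :=
    tendsto_nhdsWithin_iff.2 ⟨hs1, .of_forall fun n => (hs n).2⟩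
  have hmeasure : TendstoInMeasure haar (fun n => funExt f (s n)) atTop f :=
    tendstoInMeasure_of_tendsto_eLpNorm (p := 1) one_ne_zero
      (fun n => (continuous_funExt hf (hs n)).aestronglyMeasurable) hf.1 (by
        simp only [eLpNorm_one_eq_lintegral_enorm]
        exact (tendsto_radialError hf).comp hs_left)
  obtain ⟨φ, hφ, hae⟩ := hmeasure.exists_seq_tendsto_ae
  filter_upwards [hlimit, hae] with θ ⟨L, hL⟩ hfθ
  rwa [tendsto_nhds_unique hfθ (hL.comp (hs_left.comp hφ.tendsto_atTop))]

end Functions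

end InfTorus

end

theorem mainTheorem1 :
    -- (i)
    (∀ μ : ComplexMeasure InfTorus.Torus,
      (∀ ξ : ℂ, ‖ξ‖ < 1 → InfTorus.normOne (InfTorus.measureExt μ ξ) ≤ InfTorus.tvNorm μ) ∧
      (∀ g : C(InfTorus.Torus, ℂ),
        Tendsto (fun r : ℝ => ∫ θ, g θ * InfTorus.measureExt μ (r : ℂ) θ ∂InfTorus.haar)
          (𝓝[<] 1) (𝓝 (InfTorus.cintegral μ g)))) ∧
    -- (ii)
    ((∃ C : ℝ≥0, ∀ μ : ComplexMeasure InfTorus.Torus,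
        InfTorus.HarmonicSpectrum (InfTorus.measureCoeff μ) →
        ∀ t : ℝ, 0 < t →
          InfTorus.haar {θ | ENNReal.ofReal t < InfTorus.measureMax μ θ} ≤
            C * InfTorus.tvNorm μ / ENNReal.ofReal t) ∧
      (∀ μ : ComplexMeasure InfTorus.Torus,
        InfTorus.HarmonicSpectrum (InfTorus.measureCoeff μ) →
        ∀ᵐ θ ∂InfTorus.haar, ∃ L : ℂ,
          Tendsto (fun r : ℝ => InfTorus.measureExt μ (r : ℂ) θ) (𝓝[<] 1) (𝓝 L))) ∧
    -- (iii)
    (∀ f : InfTorus.Torus → ℂ, Integrable f InfTorus.haar →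
      InfTorus.HarmonicSpectrum (InfTorus.funCoeff f) →
      (∀ᵐ θ ∂InfTorus.haar,
        Tendsto (fun r : ℝ => InfTorus.funExt f (r : ℂ) θ) (𝓝[<] 1) (𝓝 (f θ))) ∧
      Tendsto (fun r : ℝ => InfTorus.normOne (fun θ => InfTorus.funExt f (r : ℂ) θ - f θ))
        (𝓝[<] 1) (𝓝 0)) ∧
    -- (iv)
    ((∃ C : ℝ≥0, ∀ f : InfTorus.Torus → ℂ, InfTorus.MemHardyOne f →
        ∫⁻ θ, InfTorus.funMax f θ ∂InfTorus.haar ≤ C * InfTorus.normOne f) ∧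
      (∃ C : ℝ≥0, ∀ μ : ComplexMeasure InfTorus.Torus,
        InfTorus.AnalyticSpectrum (InfTorus.measureCoeff μ) →
        ∫⁻ θ, InfTorus.measureMax μ θ ∂InfTorus.haar ≤ C * InfTorus.tvNorm μ)) := by
  refine ⟨fun μ => ⟨fun ξ hξ => ?contraction, fun g => ?weakStar⟩,
    ⟨⟨80, fun μ hμ t ht => ?weakType⟩, fun μ hμ => ?radialLimit⟩,
    fun f hf hspec => ⟨?aeConvergence, ?meanConvergence⟩,
    ⟨10240, fun f hf => ?maximalFunction⟩, ⟨10240, fun μ hμ => ?maximalMeasure⟩⟩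
  case contraction => exact InfTorus.normOne_measureExt_le μ hξ
  case weakStar => exact InfTorus.tendsto_integral_mul_measureExt μ g
  case weakType => exact InfTorus.haar_lt_measureMax_le hμ ht
  case radialLimit => exact InfTorus.ae_hasRadialLimit_measureExt hμ
  case aeConvergence => exact InfTorus.ae_tendsto_funExt hf hspec
  case meanConvergence => exact InfTorus.tendsto_radialError hf
  case maximalFunction => exact InfTorus.lintegral_funMax_le hf
  case maximalMeasure => exact InfTorus.lintegral_measureMax_le hμ
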